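/- In the minimization problem \textsc{Strongly Connected Steiner Subgraph} (SCSS), an instance $x$ is a finite directed graph $G=(V,E)$ with a set of terminals $T\subseteq V$; a feasible solution is a set $E'\subseteq E$ such that the graph $(V,E')$ contains an $s\to t$ path for all distinct $s,t\in T$; its cost is $|E'|$. Write $\mathrm{opt}(x)$ for the least cost of a feasible solution, and $|x|$ for the length of the (adjacency matrix) encoding of $x$ as a binary word. \textbf{Lemma.} SCSS has an FPT $2$-approximation: there are an algorithm $\mathbb{A}$ (a program of a random access machine with unit-cost addition and truncated subtraction), a computable function $f:\mathbb{N}\to\mathbb{N}$ and a constant $c$ such that, on every input $(x,k)$ with $x$ an instance of SCSS and $k\in\mathbb{N}$, the algorithm $\mathbb{A}$ halts within $f(k)\cdot|x|^{c}$ steps, and if $x$ has a feasible solution and $\mathrm{opt}(x)\le k$, then $\mathbb{A}$ outputs a feasible solution of $x$ of cost at most $2k$. -/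

import Mathlib

/-! ### Random access machines with unit cost

The machine has registers (addressed by constants of the program) and a memory of cells (addressed
through the registers), both holding natural numbers. The arithmetic operations are addition and
truncated subtraction only, so that unit cost and Turing machine time are polynomially related. -/

namespace RAM

/-- A configuration: the contents of the registers and of the memory cells. -/
@[ext]
structure State where
  reg : ℕ → ℕ
  mem : ℕ → ℕ

/-- Elementary instructions. -/
inductive Instr where
  /-- `R[i] := c` -/
  | const (i c : ℕ)
  /-- `R[i] := R[j] + R[l]` -/
  | add (i j l : ℕ)
  /-- `R[i] := R[j] - R[l]`, truncated at `0` -/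
  | sub (i j l : ℕ)
  /-- `R[i] := M[R[j]]` -/
  | load (i j : ℕ)
  /-- `M[R[i]] := R[j]` -/
  | store (i j : ℕ)

/-- The effect of an elementary instruction. -/
def Instr.apply : Instr → State → State
  | .const i c, s => { s with reg := Function.update s.reg i c }
  | .add i j l, s => { s with reg := Function.update s.reg i (s.reg j + s.reg l) }
  | .sub i j l, s => { s with reg := Function.update s.reg i (s.reg j - s.reg l) }
  | .load i j, s => { s with reg := Function.update s.reg i (s.mem (s.reg j)) }
  | .store i j, s => { s with mem := Function.update s.mem (s.reg i) (s.reg j) }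

/-- Programs: finite, structured, and independent of the input. -/
inductive Program where
  /-- do nothing -/
  | skip
  /-- one elementary instruction -/
  | instr (a : Instr)
  /-- first `p`, then `q` -/
  | seq (p q : Program)
  /-- if `R[i] ≠ 0` then `p` else `q` -/
  | ite (i : ℕ) (p q : Program)
  /-- while `R[i] ≠ 0` do `p` -/
  | loop (i : ℕ) (p : Program)

/-- `Exec p s t s'`: started in `s`, the program `p` halts in `s'` after exactly `t` steps. Every
elementary instruction and every test of a register is one step. -/
inductive Exec : Program → State → ℕ → State → Prop where
  | skip (s : State) : Exec .skip s 0 s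
  | instr (a : Instr) (s : State) : Exec (.instr a) s 1 (a.apply s)
  | seq {p q : Program} {s s' s'' : State} {t t' : ℕ} :
      Exec p s t s' → Exec q s' t' s'' → Exec (.seq p q) s (t + t') s''
  | ite_true {i : ℕ} {p q : Program} {s s' : State} {t : ℕ} :
      s.reg i ≠ 0 → Exec p s t s' → Exec (.ite i p q) s (t + 1) s'
  | ite_false {i : ℕ} {p q : Program} {s s' : State} {t : ℕ} :
      s.reg i = 0 → Exec q s t s' → Exec (.ite i p q) s (t + 1) s'
  | loop_done {i : ℕ} {p : Program} {s : State} :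
      s.reg i = 0 → Exec (.loop i p) s 1 s
  | loop_step {i : ℕ} {p : Program} {s s' s'' : State} {t t' : ℕ} :
      s.reg i ≠ 0 → Exec p s t s' → Exec (.loop i p) s' t' s'' →
      Exec (.loop i p) s (t + t' + 1) s''

/-- The initial configuration on input `(w, k)`: `R[0] = k`, `R[1] = |w|`, the bits of the word `w`
are in `M[0], …, M[|w| - 1]`, and everything else is `0`. -/
def initial (w : List Bool) (k : ℕ) : State where
  reg i := if i = 0 then k else if i = 1 then w.length else 0
  mem i := (w[i]?.getD false).toNat

/-- The output of a final configuration is the word `w`: `R[0] = |w|` and the bits of `w` are in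
`M[0], …, M[|w| - 1]`. -/
def State.HasOutput (s : State) (w : List Bool) : Prop :=
  s.reg 0 = w.length ∧ ∀ (i : ℕ) (h : i < w.length), s.mem i = (w[i]).toNat

end RAM

/-! ### FPT approximation algorithms for minimization problems -/

/-- A minimization problem, with encodings of instances and of solutions as binary words; feasible
solutions have length polynomial in the length of the instance. -/
structure MinProblem where
  /-- instances -/
  Inst : Type
  /-- candidate solutions of an instance -/
  Cand : Inst → Type
  /-- feasible solutions of an instance -/
  sol : (x : Inst) → Set (Cand x)
  /-- cost of a candidate -/
  cost : (x : Inst) → Cand x → ℕ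
  /-- the word that encodes an instance -/
  encInst : Inst → List Bool
  /-- the word that encodes a candidate -/
  encCand : (x : Inst) → Cand x → List Bool
  encInst_injective : Function.Injective encInst
  encCand_injective : ∀ x, Function.Injective (encCand x)
  encCand_length : ∃ c : ℕ, ∀ x, ∀ y ∈ sol x,
    (encCand x y).length ≤ (encInst x).length ^ c

/-- The length of (the encoding of) an instance. -/
def MinProblem.size (O : MinProblem) (x : O.Inst) : ℕ := (O.encInst x).length

/-- The optimum, i.e. the least cost of a feasible solution (meaningful if there is one). -/
noncomputable def MinProblem.opt (O : MinProblem) (x : O.Inst) : ℕ :=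
  sInf (O.cost x '' O.sol x)

/-- A function `ρ : ℕ → ℝ` with nonnegative values is computable if rational approximations of
`ρ k` within any error `1 / (j + 1)` can be computed from `k` and `j`. -/
def ComputableNonnegReal (ρ : ℕ → ℝ) : Prop :=
  ∃ a : ℕ → ℕ → ℕ, Computable₂ a ∧
    ∀ k j : ℕ, |ρ k - (a k j : ℝ) / ((j : ℝ) + 1)| ≤ 1 / ((j : ℝ) + 1)

/-- Admissible approximation ratios for minimization problems. -/
structure IsMinRatio (ρ : ℕ → ℝ) : Prop where
  one_le : ∀ k, 1 ≤ ρ k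
  computable : ComputableNonnegReal ρ
  mono : Monotone fun k : ℕ => (k : ℝ) * ρ k

/-- The program `A` is an FPT approximation algorithm with ratio `ρ` for `O`: on every input
`(x, k)` it halts within `f(k) * |x| ^ c` steps, where `f` is computable and `c` is a constant, and
if `x` has a feasible solution and `opt(x) ≤ k`, then it outputs a feasible solution of cost at most
`k * ρ(k)`. -/
def IsFPTApproxAlgorithm (O : MinProblem) (ρ : ℕ → ℝ) (A : RAM.Program) : Prop :=
  IsMinRatio ρ ∧
  ∃ (f : ℕ → ℕ) (c : ℕ), Computable f ∧
    ∀ (x : O.Inst) (k : ℕ), ∃ (t : ℕ) (s : RAM.State),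
      RAM.Exec A (RAM.initial (O.encInst x) k) t s ∧
      t ≤ f k * O.size x ^ c ∧
      ((O.sol x).Nonempty → O.opt x ≤ k →
        ∃ y ∈ O.sol x, s.HasOutput (O.encCand x y) ∧ (O.cost x y : ℝ) ≤ k * ρ k)

/-! ### Strongly Connected Steiner Subgraph -/

/-- An instance: a directed graph `(V, E)` with `V = {0, …, n - 1}` and a set of terminals. -/
@[ext]
structure SCSSInstance where
  n : ℕ
  edges : Finset (Fin n × Fin n)
  terminals : Finset (Fin n)

namespace SCSSInstance

/-- In the graph `(V, F)` there is a path from every terminal to every other terminal. -/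
def Connects (x : SCSSInstance) (F : Finset (Fin x.n × Fin x.n)) : Prop :=
  ∀ s ∈ x.terminals, ∀ t ∈ x.terminals, s ≠ t →
    Relation.ReflTransGen (fun u v => (u, v) ∈ F) s t

/-- The adjacency matrix of a set of edges, row by row: the bit at position `u * n + v` says whether
`(u, v)` is an edge. -/
def edgeBits {n : ℕ} (F : Finset (Fin n × Fin n)) : List Bool :=
  List.ofFn fun i : Fin (n * n) => decide (finProdFinEquiv.symm i ∈ F)

/-- The characteristic vector of a set of vertices. -/
def vertexBits {n : ℕ} (T : Finset (Fin n)) : List Bool :=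
  List.ofFn fun i : Fin n => decide (i ∈ T)

/-- The encoding of an instance: `n` in unary, the adjacency matrix, the terminals. -/
def encode (x : SCSSInstance) : List Bool :=
  List.replicate x.n true ++ false :: (edgeBits x.edges ++ vertexBits x.terminals)

theorem edgeBits_injective {n : ℕ} :
    Function.Injective (edgeBits : Finset (Fin n × Fin n) → List Bool) := by
  intro F F' h
  have h' := List.ofFn_injective h
  ext e
  have := congrFun h' (finProdFinEquiv e)
  simpa only [Equiv.symm_apply_apply, decide_eq_decide] using this

theorem vertexBits_injective {n : ℕ} :
    Function.Injective (vertexBits : Finset (Fin n) → List Bool) := by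
  intro T T' h
  have h' := List.ofFn_injective h
  ext v
  simpa only [decide_eq_decide] using congrFun h' v

theorem unary_prefix {a b : ℕ} {u v : List Bool}
    (h : List.replicate a true ++ false :: u = List.replicate b true ++ false :: v) :
    a = b ∧ u = v := by
  induction a generalizing b with
  | zero => cases b <;> simp_all [List.replicate_succ]
  | succ a ih =>
    cases b with
    | zero => simp [List.replicate_succ] at h
    | succ b =>
      simp only [List.replicate_succ, List.cons_append, List.cons.injEq, true_and] at h
      exact ⟨congrArg _ (ih h).1, (ih h).2⟩

theorem encode_injective : Function.Injective encode := by
  rintro ⟨n, E, T⟩ ⟨n', E', T'⟩ h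
  obtain ⟨h1, h2⟩ := unary_prefix h
  dsimp only at h1 h2
  subst h1
  obtain ⟨h3, h4⟩ := List.append_inj h2 (by simp [edgeBits])
  rw [edgeBits_injective h3, vertexBits_injective h4]

end SCSSInstance

/-- Strongly Connected Steiner Subgraph: find a smallest subset `F` of the edges such that `(V, F)`
has a path from every terminal to every other terminal. -/
def SCSS : MinProblem where
  Inst := SCSSInstance
  Cand x := Finset (Fin x.n × Fin x.n)
  sol x := {F | F ⊆ x.edges ∧ x.Connects F}
  cost _ F := F.card
  encInst := SCSSInstance.encode
  encCand _ F := SCSSInstance.edgeBits F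
  encInst_injective := SCSSInstance.encode_injective
  encCand_injective _ := SCSSInstance.edgeBits_injective
  encCand_length := ⟨1, fun x F _ => by
    simp only [SCSSInstance.encode, SCSSInstance.edgeBits, SCSSInstance.vertexBits,
      List.length_ofFn, List.length_append, List.length_replicate, List.length_cons, pow_one]
    omega⟩

/-!
A set of edges that connects the terminals contains, for a root `r` among the terminals, a set of
edges by which `r` reaches all terminals and a set by which all terminals reach `r`. Conversely the
union of two sets of these kinds connects the terminals. So call a graph *good* if it has an
out-going and an in-going Steiner set for `r`, each of at most `k` edges. If `opt ≤ k`, the input is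
good. The algorithm starts from the input and tries to delete each edge once, undoing the deletion
if the rest is not good. Goodness is monotone, so the outcome is good and minimal, hence it is the
union of its two Steiner sets and has at most `2 * k` edges (`Steiner.Good.card_le`).

Goodness is decided by the dynamic program of Dreyfus and Wagner: a table `D v a` holds, for each
vertex `v` and each code `a` of a set of terminals, an upper bound for the least number of edges by
which `v` reaches the set. The table is relaxed `k` times along all edges and for all splittings of
sets into two disjoint parts. The number of edges accounted for grows by one in each round
(`Steiner.Complete.succ`); the reason is that a set of edges that leaves `v` splits at an edge
`(v, u)` into this edge, a part for the vertices reached from `u` without passing through `v`, and a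
part for the other ones (`Steiner.exists_split`). If `opt ≤ k`, there are at most `k + 1` terminals,
so the table has at most `n * 2 ^ (k + 1)` entries and there are at most `3 ^ (k + 1)` splittings;
inputs with more terminals are not processed further.

The program is written in a small language with bounded loops, two-dimensional arrays and a weakest
precondition calculus (`BoundedLoop.wp`). One theorem about its compiler,
`BoundedLoop.halts_compile`, turns a correctness proof into an execution of the random access
machine. The calculus also checks that all loop bounds and array indices are at most a number `B`.
The running time is then at most `C * (B + 1) ^ D`, where `C` and `D` depend on the program only,
and for the algorithm `B` is the sum of `|x|` and `3 ^ (k + 1)`.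
-/

/-! ### A language of bounded loops -/

namespace BoundedLoop

/-- The store of a program: variables, the input and output word, two-dimensional arrays, and the
(constant) length of the input. -/
structure Store (V A : Type) where
  var : V → ℕ
  raw : ℕ → ℕ
  arr : A → ℕ → ℕ → ℕ
  len : ℕ

/-- Expressions. -/
inductive Exp (V A : Type) where
  | lit (c : ℕ)
  | var (x : V)
  | len
  | add (e f : Exp V A)
  | sub (e f : Exp V A)
  | raw (e : Exp V A)
  | arr (a : A) (e f : Exp V A)

/-- Commands. The bound of a loop is evaluated once, before the loop is entered. -/
inductive Cmd (V A : Type) where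
  | skip
  | set (x : V) (e : Exp V A)
  | putRaw (e f : Exp V A)
  | putArr (a : A) (e f g : Exp V A)
  | seq (c d : Cmd V A)
  | ite (e : Exp V A) (c d : Cmd V A)
  | repeatFor (x : V) (e : Exp V A) (c : Cmd V A)

infixr:60 " ;; " => Cmd.seq

variable {V A : Type}

/-- The value of an expression; subtraction is truncated. -/
def Exp.eval (σ : Store V A) : Exp V A → ℕ
  | .lit c => c
  | .var x => σ.var x
  | .len => σ.len
  | .add e f => e.eval σ + f.eval σ
  | .sub e f => e.eval σ - f.eval σ
  | .raw e => σ.raw (e.eval σ)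
  | .arr a e f => σ.arr a (e.eval σ) (f.eval σ)

/-- All accesses to the input word are within its length, and all array indices are at most `B`. -/
def Exp.Ok (B : ℕ) (σ : Store V A) : Exp V A → Prop
  | .lit _ => True
  | .var _ => True
  | .len => True
  | .add e f => e.Ok B σ ∧ f.Ok B σ
  | .sub e f => e.Ok B σ ∧ f.Ok B σ
  | .raw e => e.Ok B σ ∧ e.eval σ < σ.len
  | .arr _ e f => e.Ok B σ ∧ f.Ok B σ ∧ e.eval σ ≤ B ∧ f.eval σ ≤ B

section SetVar
variable [DecidableEq V]

/-- Assignment to a variable. -/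
def Store.setVar (σ : Store V A) (x : V) (v : ℕ) : Store V A :=
  { σ with var := fun y => if y = x then v else σ.var y }

@[simp] theorem Store.setVar_var (σ : Store V A) (x : V) (v : ℕ) (y : V) :
    (σ.setVar x v).var y = if y = x then v else σ.var y := rfl
@[simp] theorem Store.setVar_raw (σ : Store V A) (x : V) (v : ℕ) : (σ.setVar x v).raw = σ.raw := rfl
@[simp] theorem Store.setVar_arr (σ : Store V A) (x : V) (v : ℕ) : (σ.setVar x v).arr = σ.arr := rfl
@[simp] theorem Store.setVar_len (σ : Store V A) (x : V) (v : ℕ) : (σ.setVar x v).len = σ.len := rfl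

end SetVar

/-- Assignment to a cell of the input and output word. -/
def Store.setRaw (σ : Store V A) (i v : ℕ) : Store V A :=
  { σ with raw := fun j => if j = i then v else σ.raw j }

@[simp] theorem Store.setRaw_var (σ : Store V A) (i v : ℕ) : (σ.setRaw i v).var = σ.var := rfl
@[simp] theorem Store.setRaw_raw (σ : Store V A) (i v j : ℕ) :
    (σ.setRaw i v).raw j = if j = i then v else σ.raw j := rfl
@[simp] theorem Store.setRaw_arr (σ : Store V A) (i v : ℕ) : (σ.setRaw i v).arr = σ.arr := rfl
@[simp] theorem Store.setRaw_len (σ : Store V A) (i v : ℕ) : (σ.setRaw i v).len = σ.len := rfl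

section SetArr
variable [DecidableEq A]

/-- Assignment to an array cell. -/
def Store.setArr (σ : Store V A) (a : A) (i j v : ℕ) : Store V A :=
  { σ with arr := fun a' i' j' => if a' = a ∧ i' = i ∧ j' = j then v else σ.arr a' i' j' }

@[simp] theorem Store.setArr_var (σ : Store V A) (a : A) (i j v : ℕ) :
    (σ.setArr a i j v).var = σ.var := rfl
@[simp] theorem Store.setArr_arr (σ : Store V A) (a : A) (i j v : ℕ) (a' : A) (i' j' : ℕ) :
    (σ.setArr a i j v).arr a' i' j' = if a' = a ∧ i' = i ∧ j' = j then v else σ.arr a' i' j' := rfl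
@[simp] theorem Store.setArr_raw (σ : Store V A) (a : A) (i j v : ℕ) :
    (σ.setArr a i j v).raw = σ.raw := rfl
@[simp] theorem Store.setArr_len (σ : Store V A) (a : A) (i j v : ℕ) :
    (σ.setArr a i j v).len = σ.len := rfl

end SetArr

/-- The variables that a command may change. -/
def Cmd.modVar : Cmd V A → V → Prop
  | .skip, _ => False
  | .set x _, y => y = x
  | .putRaw _ _, _ => False
  | .putArr _ _ _ _, _ => False
  | .seq c d, y => c.modVar y ∨ d.modVar y
  | .ite _ c d, y => c.modVar y ∨ d.modVar y
  | .repeatFor x _ c, y => y = x ∨ c.modVar y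

/-- The arrays that a command may change. -/
def Cmd.modArr : Cmd V A → A → Prop
  | .skip, _ => False
  | .set _ _, _ => False
  | .putRaw _ _, _ => False
  | .putArr a _ _ _, b => b = a
  | .seq c d, y => c.modArr y ∨ d.modArr y
  | .ite _ c d, y => c.modArr y ∨ d.modArr y
  | .repeatFor _ _ c, y => c.modArr y

/-- Whether a command may change the input and output word. -/
def Cmd.modRaw : Cmd V A → Prop
  | .skip => False
  | .set _ _ => False
  | .putRaw _ _ => True
  | .putArr _ _ _ _ => False
  | .seq c d => c.modRaw ∨ d.modRaw
  | .ite _ c d => c.modRaw ∨ d.modRaw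
  | .repeatFor _ _ c => c.modRaw

/-- The stores agree on everything that `c` does not change. -/
structure Agree (c : Cmd V A) (σ τ : Store V A) : Prop where
  var : ∀ x, ¬ c.modVar x → τ.var x = σ.var x
  arr : ∀ a, ¬ c.modArr a → τ.arr a = σ.arr a
  raw : ¬ c.modRaw → τ.raw = σ.raw
  len : τ.len = σ.len

section Loop
variable [DecidableEq V]

/-- `m` iterations, with loop variable `x` running through `j, j + 1, …`, of a command whose weakest
precondition transformer is `w`. -/
def wpLoop (w : (Store V A → Prop) → Store V A → Prop) (x : V) (Q : Store V A → Prop) :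
    ℕ → ℕ → Store V A → Prop
  | 0, _ => Q
  | m + 1, j => fun σ => w (wpLoop w x Q m (j + 1)) (σ.setVar x j)

theorem wpLoop_mono {w : (Store V A → Prop) → Store V A → Prop}
    (hw : ∀ {Q R : Store V A → Prop}, (∀ τ, Q τ → R τ) → ∀ σ, w Q σ → w R σ)
    {x : V} {Q R : Store V A → Prop} (h : ∀ τ, Q τ → R τ) (m j : ℕ) (σ : Store V A) :
    wpLoop w x Q m j σ → wpLoop w x R m j σ := by
  induction m generalizing j σ with
  | zero => exact h σ
  | succ m ih => exact hw (fun τ => ih (j + 1) τ) _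

end Loop

section Logic
variable [DecidableEq V] [DecidableEq A]

/-- The weakest precondition: started in `σ`, the command ends in a store with property `Q`, all
accesses to the input word are within its length, and all loop bounds and array indices that occur
are at most `B`. -/
def wp (B : ℕ) : Cmd V A → (Store V A → Prop) → Store V A → Prop
  | .skip, Q => Q
  | .set x e, Q => fun σ => e.Ok B σ ∧ Q (σ.setVar x (e.eval σ))
  | .putRaw e f, Q => fun σ =>
      e.Ok B σ ∧ f.Ok B σ ∧ e.eval σ < σ.len ∧ Q (σ.setRaw (e.eval σ) (f.eval σ))
  | .putArr a e f g, Q => fun σ =>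
      (e.Ok B σ ∧ f.Ok B σ ∧ g.Ok B σ) ∧ e.eval σ ≤ B ∧ f.eval σ ≤ B ∧
        Q (σ.setArr a (e.eval σ) (f.eval σ) (g.eval σ))
  | .seq c d, Q => wp B c (wp B d Q)
  | .ite e c d, Q => fun σ =>
      e.Ok B σ ∧ (e.eval σ ≠ 0 → wp B c Q σ) ∧ (e.eval σ = 0 → wp B d Q σ)
  | .repeatFor x e c, Q => fun σ =>
      e.Ok B σ ∧ e.eval σ ≤ B ∧ wpLoop (wp B c) x Q (e.eval σ) 0 σ

theorem wp_mono {B : ℕ} {c : Cmd V A} {Q R : Store V A → Prop} (h : ∀ τ, Q τ → R τ)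
    (σ : Store V A) : wp B c Q σ → wp B c R σ := by
  induction c generalizing Q R σ with
  | skip => exact h σ
  | set x e => exact fun H => ⟨H.1, h _ H.2⟩
  | putRaw e f => exact fun H => ⟨H.1, H.2.1, H.2.2.1, h _ H.2.2.2⟩
  | putArr a e f g => exact fun H => ⟨H.1, H.2.1, H.2.2.1, h _ H.2.2.2⟩
  | seq c d ihc ihd => exact ihc (fun τ => ihd h τ) σ
  | ite e c d ihc ihd =>
    exact fun H => ⟨H.1, fun k => ihc h σ (H.2.1 k), fun k => ihd h σ (H.2.2 k)⟩
  | repeatFor x e c ih => exact fun H => ⟨H.1, H.2.1, wpLoop_mono ih h _ _ _ H.2.2⟩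

/-- The frame rule, for a store `σ` that is reached from `σ₀` in the execution of a larger command
`c₀`. -/
theorem wp_frame_aux {B : ℕ} {c : Cmd V A} {Q : Store V A → Prop}
    (σ₀ σ : Store V A) (c₀ : Cmd V A) (hv : ∀ x, c.modVar x → c₀.modVar x)
    (ha : ∀ a, c.modArr a → c₀.modArr a) (hr : c.modRaw → c₀.modRaw) (h₀ : Agree c₀ σ₀ σ) :
    wp B c Q σ → wp B c (fun τ => Agree c₀ σ₀ τ ∧ Q τ) σ := by
  induction c generalizing Q σ with
  | skip => exact fun h => ⟨h₀, h⟩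
  | set x e =>
    refine fun h => ⟨h.1, ⟨fun y hy => ?_, h₀.arr, h₀.raw, h₀.len⟩, h.2⟩
    have : y ≠ x := fun h => hy (hv y h)
    simpa [this] using h₀.var y hy
  | putRaw e f =>
    exact fun h => ⟨h.1, h.2.1, h.2.2.1, ⟨h₀.var, h₀.arr, fun k => (k (hr trivial)).elim, h₀.len⟩,
      h.2.2.2⟩
  | putArr a e f g =>
    refine fun h => ⟨h.1, h.2.1, h.2.2.1, ⟨h₀.var, fun b hb => ?_, h₀.raw, h₀.len⟩, h.2.2.2⟩
    have : b ≠ a := fun h => hb (ha b h)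
    rw [← h₀.arr b hb]
    funext i j
    simp [this]
  | seq c d ihc ihd =>
    intro h
    refine wp_mono (c := c) (R := wp B d _) ?_ _ (ihc σ (fun x k => hv x (Or.inl k))
      (fun x k => ha x (Or.inl k)) (fun k => hr (Or.inl k)) h₀ h)
    rintro τ ⟨hτ, h⟩
    exact ihd τ (fun x k => hv x (Or.inr k)) (fun x k => ha x (Or.inr k))
      (fun k => hr (Or.inr k)) hτ h
  | ite e c d ihc ihd =>
    intro h
    exact ⟨h.1, fun k => ihc σ (fun x k => hv x (Or.inl k)) (fun x k => ha x (Or.inl k))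
      (fun k => hr (Or.inl k)) h₀ (h.2.1 k), fun k => ihd σ (fun x k => hv x (Or.inr k))
      (fun x k => ha x (Or.inr k)) (fun k => hr (Or.inr k)) h₀ (h.2.2 k)⟩
  | repeatFor x e c ih =>
    intro h
    refine ⟨h.1, h.2.1, ?_⟩
    have key : ∀ m j σ, Agree c₀ σ₀ σ → wpLoop (wp B c) x Q m j σ →
        wpLoop (wp B c) x (fun τ => Agree c₀ σ₀ τ ∧ Q τ) m j σ := by
      intro m
      induction m with
      | zero => exact fun j σ hσ h => ⟨hσ, h⟩
      | succ m ihm =>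
        intro j σ hσ h
        refine wp_mono ?_ _ (ih (σ.setVar x j) (fun x k => hv x (Or.inr k)) (fun x k => ha x k)
          hr ⟨fun y hy => ?_, hσ.arr, hσ.raw, hσ.len⟩ h)
        · rintro τ ⟨hτ, h⟩
          exact ihm _ _ hτ h
        · have : y ≠ x := fun h => hy (hv y (Or.inl h))
          simpa [this] using hσ.var y hy
    exact key _ _ _ h₀ h.2.2

/-- A command changes nothing but what occurs in it as the target of an assignment. -/
theorem wp_frame {B : ℕ} {c : Cmd V A} {Q : Store V A → Prop} {σ : Store V A}
    (h : wp B c Q σ) : wp B c (fun τ => Agree c σ τ ∧ Q τ) σ :=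
  wp_frame_aux σ σ c (fun _ h => h) (fun _ h => h) (fun h => h)
    ⟨fun _ _ => rfl, fun _ _ => rfl, fun _ => rfl, rfl⟩ h

/-- The rule of consequence, combined with the frame rule. -/
theorem wp_conseq {B : ℕ} {c : Cmd V A} {Q R : Store V A → Prop} {σ : Store V A}
    (h : wp B c Q σ) (hR : ∀ τ, Agree c σ τ → Q τ → R τ) : wp B c R σ :=
  wp_mono (fun τ h => hR τ h.1 h.2) σ (wp_frame h)

theorem wp_seq {B : ℕ} {c d : Cmd V A} {Q R : Store V A → Prop} {σ : Store V A}
    (h : wp B c R σ) (hR : ∀ τ, Agree c σ τ → R τ → wp B d Q τ) : wp B (c ;; d) Q σ :=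
  wp_conseq (c := c) h hR

/-- The invariant rule for loops. In each iteration, the store still agrees with the store before
the loop on everything that the loop does not change. -/
theorem wp_repeatFor {B : ℕ} {x : V} {e : Exp V A} {c : Cmd V A} {Q : Store V A → Prop}
    {σ : Store V A} (I : ℕ → Store V A → Prop) (N : ℕ) (he : e.Ok B σ) (hN : e.eval σ = N)
    (hB : N ≤ B) (h₀ : I 0 σ)
    (step : ∀ j < N, ∀ τ, Agree (.repeatFor x e c) σ τ → I j τ →
      wp B c (I (j + 1)) (τ.setVar x j))
    (hQ : ∀ τ, Agree (.repeatFor x e c) σ τ → I N τ → Q τ) :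
    wp B (.repeatFor x e c) Q σ := by
  have key : ∀ m j τ, j + m = N → Agree (.repeatFor x e c) σ τ → I j τ →
      wpLoop (wp B c) x Q m j τ := by
    intro m
    induction m with
    | zero =>
      intro j τ hj hτ h
      obtain rfl : j = N := hj
      exact hQ τ hτ h
    | succ m ih =>
      intro j τ hj hτ h
      have := wp_frame_aux σ (τ.setVar x j) (.repeatFor x e c) (fun _ h => Or.inr h)
        (fun _ h => h) (fun h => h)
        ⟨fun y hy => by
          have : y ≠ x := fun h => hy (Or.inl h)
          simpa [this] using hτ.var y hy, hτ.arr, hτ.raw, hτ.len⟩ (step j (by omega) τ hτ h)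
      exact wp_mono (fun τ' h => ih (j + 1) τ' (by omega) h.1 h.2) _ this
  subst hN
  exact ⟨he, hB, key _ 0 σ (by omega)
    ⟨fun _ _ => rfl, fun _ _ => rfl, fun _ => rfl, rfl⟩ h₀⟩

end Logic

/-! ### Compiling bounded loops to a random access machine -/

open RAM

/-- Started in `s`, the program halts within `T` steps in a configuration with property `Q`. -/
def Halts (p : Program) (s : State) (T : ℕ) (Q : State → Prop) : Prop :=
  ∃ t s', Exec p s t s' ∧ t ≤ T ∧ Q s'

theorem Halts.mono {p : Program} {s : State} {T T' : ℕ} {Q Q' : State → Prop}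
    (h : Halts p s T Q) (hT : T ≤ T') (hQ : ∀ s', Q s' → Q' s') : Halts p s T' Q' := by
  obtain ⟨t, s', h, ht, hq⟩ := h
  exact ⟨t, s', h, ht.trans hT, hQ _ hq⟩

theorem Halts.skip {s : State} {Q : State → Prop} (h : Q s) : Halts .skip s 0 Q :=
  ⟨0, s, .skip s, le_rfl, h⟩

theorem Halts.instr {a : Instr} {s : State} {Q : State → Prop} (h : Q (a.apply s)) :
    Halts (.instr a) s 1 Q :=
  ⟨1, _, .instr a s, le_rfl, h⟩

theorem Halts.seq {p q : Program} {s : State} {T T' : ℕ} {R Q : State → Prop}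
    (h : Halts p s T R) (h' : ∀ s', R s' → Halts q s' T' Q) : Halts (.seq p q) s (T + T') Q := by
  obtain ⟨t, s', h, ht, hq⟩ := h
  obtain ⟨t', s'', h', ht', hq'⟩ := h' s' hq
  exact ⟨_, _, .seq h h', by omega, hq'⟩

theorem Halts.instr_seq {a : Instr} {q : Program} {s : State} {T : ℕ} {Q : State → Prop}
    (h : Halts q (a.apply s) T Q) : Halts (.seq (.instr a) q) s (1 + T) Q := by
  obtain ⟨t', s'', h', ht', hq'⟩ := h
  exact ⟨_, _, .seq (.instr a s) h', by omega, hq'⟩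

/-- A numbering of the elements of a type: of the variables, or of the arrays of a program. -/
class Numbered (X : Type) where
  num : X → ℕ
  num_injective : Function.Injective num

/-- The `d`-th auxiliary register. The register `tmp 0` holds the length of the input. -/
def tmp (d : ℕ) : ℕ := 2 * d + 1

/-- The register that holds a variable. -/
def varReg [Numbered V] (x : V) : ℕ := 2 * Numbered.num x

/-- An injective pairing with polynomially bounded values. -/
def cell (i j : ℕ) : ℕ := i + (i + j) * (i + j)

theorem cell_inj {i j i' j' : ℕ} (h : cell i j = cell i' j') : i = i' ∧ j = j' := by
  unfold cell at h
  have h1 : i + j = i' + j' := by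
    by_contra hne
    rcases Nat.lt_or_gt_of_ne hne with hlt | hlt
    · have := Nat.mul_le_mul (Nat.succ_le_of_lt hlt) (Nat.succ_le_of_lt hlt)
      simp only [Nat.succ_eq_add_one] at this
      nlinarith
    · have := Nat.mul_le_mul (Nat.succ_le_of_lt hlt) (Nat.succ_le_of_lt hlt)
      simp only [Nat.succ_eq_add_one] at this
      nlinarith
  rw [h1] at h
  omega

/-- The register `r` is not one of the auxiliary registers from the `d`-th on. -/
def Outside (d r : ℕ) : Prop := ∀ e, d ≤ e → r ≠ tmp e

theorem Outside.mono {d d' r : ℕ} (h : Outside d r) (hd : d ≤ d') : Outside d' r :=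
  fun e he => h e (hd.trans he)

theorem outside_tmp {d e : ℕ} (h : e < d) : Outside d (tmp e) := by
  intro f hf
  unfold tmp
  omega

theorem outside_varReg [Numbered V] (d : ℕ) (x : V) : Outside d (varReg x) := by
  intro f _
  unfold varReg tmp
  omega

theorem tmp_inj {d e : ℕ} : tmp d = tmp e ↔ d = e := by
  unfold tmp
  omega

/-- The effect of a computation of `v` in the auxiliary registers from the `d`-th on. -/
structure Computed (d : ℕ) (s s' : State) (v : ℕ) : Prop where
  mem : s'.mem = s.mem
  reg : ∀ r, Outside d r → s'.reg r = s.reg r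
  val : s'.reg (tmp d) = v

/-- Adds the register `y` to the register `x`, as often as the counter `c` says; the register `o`
holds `1`. -/
def addLoop (x y c o : ℕ) : Program :=
  .loop c (.seq (.instr (.add x x y)) (.instr (.sub c c o)))

theorem halts_addLoop {x y c o : ℕ} (hxy : x ≠ y) (hxc : x ≠ c) (hxo : x ≠ o) (hcy : c ≠ y)
    (hco : c ≠ o) (s : State) (ho : s.reg o = 1) :
    Halts (addLoop x y c o) s (3 * s.reg c + 1) fun s' => s'.mem = s.mem ∧
      s'.reg x = s.reg x + s.reg c * s.reg y ∧ ∀ r, r ≠ x → r ≠ c → s'.reg r = s.reg r := by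
  generalize hn : s.reg c = n
  induction n generalizing s with
  | zero => exact ⟨1, s, .loop_done hn, by omega, rfl, by simp, fun _ _ _ => rfl⟩
  | succ n ih =>
    obtain ⟨t, s', h, ht, hm, hx, hr⟩ := ih
      ((Instr.sub c c o).apply ((Instr.add x x y).apply s))
      (by simp [Instr.apply, Function.update_apply, hxo.symm, hco.symm, ho])
      (by simp [Instr.apply, hxo.symm, hxc.symm, ho, hn])
    refine ⟨_, s', .loop_step (by omega) (.seq (.instr _ _) (.instr _ _)) h, by omega, hm, ?_,
      fun r h1 h2 => ?_⟩
    · rw [hx]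
      simp [Instr.apply, Function.update_apply, hxc, hxy.symm, hcy.symm]
      ring
    · rw [hr r h1 h2]
      simp [Instr.apply, Function.update_apply, h1, h2]

/-- Replaces the register `tmp d` by its pairing with `tmp (d + 1)`. -/
def pairProg (d : ℕ) : Program :=
  .seq (.instr (.add (tmp (d + 1)) (tmp d) (tmp (d + 1))))
  (.seq (.instr (.const (tmp (d + 2)) 1))
  (.seq (.instr (.const (tmp (d + 3)) 0))
  (.seq (.instr (.add (tmp (d + 3)) (tmp (d + 3)) (tmp (d + 1))))
  (addLoop (tmp d) (tmp (d + 1)) (tmp (d + 3)) (tmp (d + 2))))))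

theorem halts_pairProg (d : ℕ) (s : State) :
    Halts (pairProg d) s (3 * (s.reg (tmp d) + s.reg (tmp (d + 1))) + 5) fun s' =>
      Computed d s s' (cell (s.reg (tmp d)) (s.reg (tmp (d + 1)))) := by
  refine Halts.mono (Halts.instr_seq (Halts.instr_seq (Halts.instr_seq (Halts.instr_seq
    (halts_addLoop ?_ ?_ ?_ ?_ ?_ _ ?_))))) ?_ ?_
  · simp [tmp_inj]
  · simp [tmp_inj]
  · simp [tmp_inj]
  · simp [tmp_inj]
  · simp [tmp_inj]
  · simp [Instr.apply, tmp_inj]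
  · simp [Instr.apply, tmp_inj]
    omega
  · rintro s' ⟨hm, hx, hr⟩
    refine ⟨hm, fun r h => ?_, ?_⟩
    · rw [hr r (h _ (by omega)) (h _ (by omega))]
      simp [Instr.apply, Function.update_apply, h (d + 1) (by omega),
        h (d + 2) (by omega), h (d + 3) (by omega)]
    · rw [hx]
      simp [Instr.apply, tmp_inj, cell]

section Compile
variable [Numbered V] [Numbered A]

/-- Turns the indices of a cell of the array `a`, in `tmp d` and `tmp (d + 1)`, into the address of
the cell, in `tmp d`. -/
def addrProg (a : A) (d : ℕ) : Program :=
  .seq (pairProg d) (.seq (.instr (.const (tmp (d + 1)) (Numbered.num a)))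
    (.seq (pairProg d) (.instr (.add (tmp d) (tmp d) (tmp 0)))))

/-- The memory address of an array cell, if the input has length `L`. -/
def addr (L : ℕ) (a : A) (i j : ℕ) : ℕ := cell (cell i j) (Numbered.num a) + L

theorem addr_inj {L : ℕ} {a a' : A} {i j i' j' : ℕ} :
    addr L a i j = addr L a' i' j' ↔ a = a' ∧ i = i' ∧ j = j' := by
  refine ⟨fun h => ?_, by rintro ⟨rfl, rfl, rfl⟩; rfl⟩
  obtain ⟨h1, h2⟩ := cell_inj (Nat.add_right_cancel h)
  exact ⟨Numbered.num_injective h2, cell_inj h1⟩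

/-- The program that leaves the value of an expression in `tmp d`. -/
def compileExp : Exp V A → ℕ → Program
  | .lit c, d => .instr (.const (tmp d) c)
  | .var x, d => .seq (.instr (.const (tmp d) 0)) (.instr (.add (tmp d) (tmp d) (varReg x)))
  | .len, d => .seq (.instr (.const (tmp d) 0)) (.instr (.add (tmp d) (tmp d) (tmp 0)))
  | .add e f, d => .seq (compileExp e d) (.seq (compileExp f (d + 1))
      (.instr (.add (tmp d) (tmp d) (tmp (d + 1)))))
  | .sub e f, d => .seq (compileExp e d) (.seq (compileExp f (d + 1))
      (.instr (.sub (tmp d) (tmp d) (tmp (d + 1)))))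
  | .raw e, d => .seq (compileExp e d) (.instr (.load (tmp d) (tmp d)))
  | .arr a e f, d => .seq (compileExp e d) (.seq (compileExp f (d + 1)) (.seq (addrProg a d)
      (.instr (.load (tmp d) (tmp d)))))

/-- The program of a command; it uses the auxiliary registers from the `d`-th on. -/
def compile : Cmd V A → ℕ → Program
  | .skip, _ => .skip
  | .set x e, d => .seq (compileExp e d) (.seq (.instr (.const (varReg x) 0))
      (.instr (.add (varReg x) (varReg x) (tmp d))))
  | .putRaw e f, d => .seq (compileExp e d) (.seq (compileExp f (d + 1))
      (.instr (.store (tmp d) (tmp (d + 1)))))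
  | .putArr a e f g, d => .seq (compileExp e d) (.seq (compileExp f (d + 1))
      (.seq (addrProg a d) (.seq (compileExp g (d + 1)) (.instr (.store (tmp d) (tmp (d + 1)))))))
  | .seq c c', d => .seq (compile c d) (compile c' d)
  | .ite e c c', d => .seq (compileExp e d) (.ite (tmp d) (compile c d) (compile c' d))
  | .repeatFor x e c, d => .seq (compileExp e d) (.seq (.instr (.const (tmp (d + 1)) 0))
      (.loop (tmp d) (.seq (.instr (.const (varReg x) 0))
        (.seq (.instr (.add (varReg x) (varReg x) (tmp (d + 1))))
        (.seq (compile c (d + 2)) (.seq (.instr (.const (tmp (d + 2)) 1))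
        (.seq (.instr (.add (tmp (d + 1)) (tmp (d + 1)) (tmp (d + 2))))
        (.instr (.sub (tmp d) (tmp d) (tmp (d + 2)))))))))))

/-- The configuration represents the store: variables are in the even registers, the input and
output word is at the beginning of the memory, and the arrays come after it. -/
structure Rep (σ : Store V A) (s : State) : Prop where
  var : ∀ x, s.reg (varReg x) = σ.var x
  len : s.reg (tmp 0) = σ.len
  raw : ∀ i < σ.len, s.mem i = σ.raw i
  arr : ∀ a i j, s.mem (addr σ.len a i j) = σ.arr a i j

theorem Rep.congr {σ : Store V A} {s s' : State} {d : ℕ} (h : Rep σ s) (hd : 1 ≤ d)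
    (hm : s'.mem = s.mem) (hr : ∀ r, Outside d r → s'.reg r = s.reg r) : Rep σ s' where
  var x := by rw [hr _ (outside_varReg d x), h.var]
  len := by rw [hr _ (outside_tmp (by omega)), h.len]
  raw i hi := by rw [hm, h.raw i hi]
  arr a i j := by rw [hm, h.arr]

theorem halts_addrProg (a : A) {d : ℕ} (hd : 1 ≤ d) (B : ℕ) (s : State)
    (h1 : s.reg (tmp d) ≤ B) (h2 : s.reg (tmp (d + 1)) ≤ B) :
    Halts (addrProg a d) s ((35 + 3 * Numbered.num a) * (B + 1) ^ 2) fun s' =>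
      Computed d s s' (addr (s.reg (tmp 0)) a (s.reg (tmp d)) (s.reg (tmp (d + 1)))) := by
  have hB : cell (s.reg (tmp d)) (s.reg (tmp (d + 1))) ≤ B + (B + B) * (B + B) :=
    Nat.add_le_add h1 (Nat.mul_le_mul (by omega) (by omega))
  refine Halts.mono (T := (3 * (B + B) + 5) + (1 +
    ((3 * (B + (B + B) * (B + B) + Numbered.num a) + 5) + 1)))
    (Halts.seq ((halts_pairProg d s).mono (by omega) fun _ h => h) fun s₁ hs₁ =>
    Halts.instr_seq (Halts.seq ((halts_pairProg d _).mono ?_ fun _ h => h) fun s₂ hs₂ =>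
    Halts.instr ?_)) ?_ fun _ h => h
  · simp [Instr.apply, tmp_inj, hs₁.val]
    exact hB
  · refine ⟨?_, fun r hr => ?_, ?_⟩
    · simpa [Instr.apply, hs₁.mem] using hs₂.mem
    · have := hs₂.reg r hr
      simp [Instr.apply, hr d le_rfl, hr (d + 1) (by omega)] at this ⊢
      rw [this, hs₁.reg r hr]
    · have h0 := hs₂.reg (tmp 0) (outside_tmp (by omega))
      have h0' := hs₁.reg (tmp 0) (outside_tmp (by omega))
      have := hs₂.val
      simp [Instr.apply, tmp_inj, hs₁.val] at this h0 ⊢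
      rw [this, h0, h0']
      rfl
  · nlinarith [Nat.zero_le B, Nat.zero_le (Numbered.num a * B),
      Nat.zero_le (Numbered.num a * (B * B))]

/-- The exponent `2` of the time bound comes from the computation of addresses: the outer pairing
in `addr` runs a loop as often as the value of the inner pairing says. -/
theorem halts_compileExp (e : Exp V A) : ∃ C, ∀ (d B : ℕ) (σ : Store V A) (s : State), 1 ≤ d →
    Rep σ s → e.Ok B σ → Halts (compileExp e d) s (C * (B + 1) ^ 2) fun s' =>
      Computed d s s' (e.eval σ) := by
  have one : ∀ B : ℕ, 1 ≤ (B + 1) ^ 2 := fun B => Nat.one_le_pow _ _ (by omega)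
  induction e with
  | lit c =>
    refine ⟨1, fun d B σ s hd hs _ => Halts.mono (Halts.instr ?_) (by have := one B; omega)
      fun _ h => h⟩
    refine ⟨rfl, fun r hr => ?_, ?_⟩
    · simp [Instr.apply, hr d le_rfl]
    · simp [Instr.apply, Exp.eval]
  | var x =>
    refine ⟨2, fun d B σ s hd hs _ => Halts.mono (Halts.instr_seq (Halts.instr ?_))
      (by have := one B; omega) fun _ h => h⟩
    refine ⟨rfl, fun r hr => ?_, ?_⟩
    · simp [Instr.apply, Function.update_apply, hr d le_rfl]
    · simp [Instr.apply, Exp.eval, outside_varReg d x d le_rfl, hs.var]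
  | len =>
    refine ⟨2, fun d B σ s hd hs _ => Halts.mono (Halts.instr_seq (Halts.instr ?_))
      (by have := one B; omega) fun _ h => h⟩
    refine ⟨rfl, fun r hr => ?_, ?_⟩
    · simp [Instr.apply, Function.update_apply, hr d le_rfl]
    · have : 0 ≠ d := by omega
      simp [Instr.apply, Exp.eval, tmp_inj, hs.len, this]
  | add e f ihe ihf =>
    obtain ⟨C, hC⟩ := ihe
    obtain ⟨C', hC'⟩ := ihf
    refine ⟨C + (C' + 1), fun d B σ s hd hs ho => Halts.mono (Halts.seq (hC d B σ s hd hs ho.1)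
      fun s₁ h₁ => Halts.seq (hC' (d + 1) B σ s₁ (by omega) (hs.congr hd h₁.mem h₁.reg) ho.2)
      fun s₂ h₂ => Halts.instr ?_) ?_ fun _ h => h⟩
    · refine ⟨by simp [Instr.apply, h₂.mem, h₁.mem], fun r hr => ?_, ?_⟩
      · simp [Instr.apply, hr d le_rfl, h₂.reg r (hr.mono (by omega)),
          h₁.reg r hr]
      · simp [Instr.apply, h₂.val, h₂.reg _ (outside_tmp (Nat.lt_succ_self d)), h₁.val, Exp.eval]
    · have := one B
      simp only [add_mul, one_mul]
      omega
  | sub e f ihe ihf =>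
    obtain ⟨C, hC⟩ := ihe
    obtain ⟨C', hC'⟩ := ihf
    refine ⟨C + (C' + 1), fun d B σ s hd hs ho => Halts.mono (Halts.seq (hC d B σ s hd hs ho.1)
      fun s₁ h₁ => Halts.seq (hC' (d + 1) B σ s₁ (by omega) (hs.congr hd h₁.mem h₁.reg) ho.2)
      fun s₂ h₂ => Halts.instr ?_) ?_ fun _ h => h⟩
    · refine ⟨by simp [Instr.apply, h₂.mem, h₁.mem], fun r hr => ?_, ?_⟩
      · simp [Instr.apply, hr d le_rfl, h₂.reg r (hr.mono (by omega)),
          h₁.reg r hr]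
      · simp [Instr.apply, h₂.val, h₂.reg _ (outside_tmp (Nat.lt_succ_self d)), h₁.val, Exp.eval]
    · have := one B
      simp only [add_mul, one_mul]
      omega
  | raw e ihe =>
    obtain ⟨C, hC⟩ := ihe
    refine ⟨C + 1, fun d B σ s hd hs ho => Halts.mono (Halts.seq (hC d B σ s hd hs ho.1)
      fun s₁ h₁ => Halts.instr ?_) ?_ fun _ h => h⟩
    · refine ⟨by simp [Instr.apply, h₁.mem], fun r hr => ?_, ?_⟩
      · simp [Instr.apply, hr d le_rfl, h₁.reg r hr]
      · simp [Instr.apply, h₁.val, h₁.mem, Exp.eval, hs.raw _ ho.2]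
    · have := one B
      simp only [add_mul, one_mul]
      omega
  | arr a e f ihe ihf =>
    obtain ⟨C, hC⟩ := ihe
    obtain ⟨C', hC'⟩ := ihf
    refine ⟨C + (C' + ((35 + 3 * Numbered.num a) + 1)), fun d B σ s hd hs ho =>
      Halts.mono (Halts.seq (hC d B σ s hd hs ho.1)
      fun s₁ h₁ => Halts.seq (hC' (d + 1) B σ s₁ (by omega) (hs.congr hd h₁.mem h₁.reg) ho.2.1)
      fun s₂ h₂ => Halts.seq (halts_addrProg a hd B s₂ ?_ ?_)
      fun s₃ h₃ => Halts.instr ?_) ?_ fun _ h => h⟩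
    · rw [h₂.reg _ (outside_tmp (Nat.lt_succ_self d)), h₁.val]
      exact ho.2.2.1
    · rw [h₂.val]
      exact ho.2.2.2
    · refine ⟨by simp [Instr.apply, h₃.mem, h₂.mem, h₁.mem], fun r hr => ?_, ?_⟩
      · simp [Instr.apply, hr d le_rfl, h₃.reg r hr,
          h₂.reg r (hr.mono (by omega)), h₁.reg r hr]
      · simp [Instr.apply, h₃.val, h₃.mem, h₂.mem, h₁.mem, h₂.val, h₁.val,
          h₂.reg _ (outside_tmp (Nat.lt_succ_self d)), Exp.eval,
          h₂.reg _ (outside_tmp (Nat.succ_pos d)), h₁.reg _ (outside_tmp hd), hs.len, hs.arr]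
    · have := one B
      simp only [add_mul, one_mul]
      omega

theorem Rep.setVar [DecidableEq V] {σ : Store V A} {s s' : State} {d : ℕ} (h : Rep σ s)
    (hd : 1 ≤ d) (hm : s'.mem = s.mem) (x : V) (v : ℕ) (hv : s'.reg (varReg x) = v)
    (hr : ∀ r, Outside d r → r ≠ varReg x → s'.reg r = s.reg r) : Rep (σ.setVar x v) s' where
  var y := by
    by_cases hy : y = x
    · simp [hy, hv]
    · have : varReg y ≠ varReg x := by
        simpa [varReg, Numbered.num_injective.eq_iff] using hy
      simp [hy, hr _ (outside_varReg d y) this, h.var]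
  len := by
    rw [hr _ (outside_tmp (by omega)) (outside_varReg 0 x _ le_rfl).symm, h.len]
    rfl
  raw i hi := by
    rw [hm]
    exact h.raw i hi
  arr a i j := by
    rw [hm]
    exact h.arr a i j

/-- Compiled commands do what the weakest precondition says, within a time that is polynomial in a
bound on the loop bounds and array indices that occur. -/
theorem halts_compile [DecidableEq V] [DecidableEq A] (c : Cmd V A) : ∃ C D, ∀ (d B : ℕ)
    (σ : Store V A) (s : State) (Q : Store V A → Prop), 1 ≤ d → Rep σ s → wp B c Q σ →
    Halts (compile c d) s (C * (B + 1) ^ D) fun s' =>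
      (∃ σ', Rep σ' s' ∧ Q σ') ∧ ∀ e < d, s'.reg (tmp e) = s.reg (tmp e) := by
  have one : ∀ B D : ℕ, 1 ≤ (B + 1) ^ D := fun B D => Nat.one_le_pow _ _ (by omega)
  induction c with
  | skip =>
    exact ⟨0, 0, fun d B σ s Q hd hs h => Halts.mono (Halts.skip ⟨⟨σ, hs, h⟩, fun _ _ => rfl⟩)
      (by omega) fun _ h => h⟩
  | set x e =>
    obtain ⟨C, hC⟩ := halts_compileExp e
    refine ⟨C + 2, 2, fun d B σ s Q hd hs h => Halts.mono (Halts.seq (hC d B σ s hd hs h.1)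
      fun s₁ h₁ => Halts.instr_seq (Halts.instr ?_)) ?_ fun _ h => h⟩
    · refine ⟨⟨_, hs.setVar hd ?_ x (e.eval σ) ?_ fun r hr hx => ?_, h.2⟩, fun k hk => ?_⟩
      · simp [Instr.apply, h₁.mem]
      · simp [Instr.apply, (outside_varReg d x d le_rfl).symm, h₁.val]
      · simp [Instr.apply, Function.update_apply, hx, h₁.reg r hr]
      · simp [Instr.apply, Function.update_apply, (outside_varReg 0 x k (by omega)).symm,
          h₁.reg _ (outside_tmp hk)]
    · have := one B 2
      simp only [add_mul]
      omega
  | putRaw e f =>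
    obtain ⟨C, hC⟩ := halts_compileExp e
    obtain ⟨C', hC'⟩ := halts_compileExp f
    refine ⟨C + (C' + 1), 2, fun d B σ s Q hd hs h => Halts.mono (Halts.seq (hC d B σ s hd hs h.1)
      fun s₁ h₁ => Halts.seq (hC' (d + 1) B σ s₁ (by omega) (hs.congr hd h₁.mem h₁.reg) h.2.1)
      fun s₂ h₂ => Halts.instr ?_) ?_ fun _ h => h⟩
    · have hs₂ := (hs.congr hd h₁.mem h₁.reg).congr (d := d + 1) (by omega) h₂.mem h₂.reg
      refine ⟨⟨σ.setRaw (e.eval σ) (f.eval σ), ⟨hs₂.var, hs₂.len, fun i hi => ?_, fun a i j => ?_⟩, h.2.2.2⟩, fun k hk => ?_⟩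
      · simp [Instr.apply, Function.update_apply, h₂.val,
          h₂.reg _ (outside_tmp (Nat.lt_succ_self d)), h₁.val, hs₂.raw i hi]
      · have : addr σ.len a i j ≠ e.eval σ := by
          have := h.2.2.1
          unfold addr
          omega
        simp [Instr.apply, h₂.val,
          h₂.reg _ (outside_tmp (Nat.lt_succ_self d)), h₁.val, hs₂.arr a i j, this]
      · simp [Instr.apply, h₂.reg _ (outside_tmp (by omega : k < d + 1)),
          h₁.reg _ (outside_tmp hk)]
    · have := one B 2
      simp only [add_mul]
      omega
  | putArr a e f g =>
    obtain ⟨C, hC⟩ := halts_compileExp e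
    obtain ⟨C', hC'⟩ := halts_compileExp f
    obtain ⟨C'', hC''⟩ := halts_compileExp g
    refine ⟨C + (C' + ((35 + 3 * Numbered.num a) + (C'' + 1))), 2, fun d B σ s Q hd hs h =>
      Halts.mono (Halts.seq (hC d B σ s hd hs h.1.1) fun s₁ h₁ => Halts.seq
      (hC' (d + 1) B σ s₁ (by omega) (hs.congr hd h₁.mem h₁.reg) h.1.2.1) fun s₂ h₂ =>
      Halts.seq (halts_addrProg a hd B s₂ ?_ ?_) fun s₃ h₃ => Halts.seq
      (hC'' (d + 1) B σ s₃ (by omega) (((hs.congr hd h₁.mem h₁.reg).congr (d := d + 1) (by omega)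
        h₂.mem h₂.reg).congr hd h₃.mem h₃.reg) h.1.2.2) fun s₄ h₄ => Halts.instr ?_) ?_
      fun _ h => h⟩
    · rw [h₂.reg _ (outside_tmp (Nat.lt_succ_self d)), h₁.val]
      exact h.2.1
    · rw [h₂.val]
      exact h.2.2.1
    · have hs₄ := (((hs.congr hd h₁.mem h₁.reg).congr (d := d + 1) (by omega)
        h₂.mem h₂.reg).congr hd h₃.mem h₃.reg).congr (d := d + 1) (by omega) h₄.mem h₄.reg
      have hadr : s₄.reg (tmp d) = addr σ.len a (e.eval σ) (f.eval σ) := by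
        rw [h₄.reg _ (outside_tmp (Nat.lt_succ_self d)), h₃.val, h₂.val,
          h₂.reg _ (outside_tmp (Nat.lt_succ_self d)), h₁.val,
          h₂.reg _ (outside_tmp (Nat.succ_pos d)), h₁.reg _ (outside_tmp hd), hs.len]
      refine ⟨⟨σ.setArr a (e.eval σ) (f.eval σ) (g.eval σ), ⟨hs₄.var, hs₄.len, fun i hi => ?_, fun b i j => ?_⟩, h.2.2.2⟩, fun k hk => ?_⟩
      · have : i ≠ addr σ.len a (e.eval σ) (f.eval σ) := by
          have : i < σ.len := hi
          unfold addr
          omega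
        simp [Instr.apply, hadr, hs₄.raw i hi, this]
      · simp [Instr.apply, Function.update_apply, hadr, h₄.val, hs₄.arr b i j, addr_inj]
      · simp [Instr.apply, h₄.reg _ (outside_tmp (by omega : k < d + 1)),
          h₃.reg _ (outside_tmp hk), h₂.reg _ (outside_tmp (by omega : k < d + 1)),
          h₁.reg _ (outside_tmp hk)]
    · have := one B 2
      simp only [add_mul]
      omega
  | seq c c' ih ih' =>
    obtain ⟨C, D, hC⟩ := ih
    obtain ⟨C', D', hC'⟩ := ih'
    refine ⟨C + C', D + D', fun d B σ s Q hd hs h => Halts.mono (Halts.seq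
      (hC d B σ s _ hd hs h) fun s₁ h₁ => Halts.mono (hC' d B h₁.1.choose s₁ Q hd
      h₁.1.choose_spec.1 h₁.1.choose_spec.2) le_rfl fun s₂ h₂ =>
      ⟨h₂.1, fun e he => (h₂.2 e he).trans (h₁.2 e he)⟩) ?_ fun _ h => h⟩
    rw [add_mul]
    exact Nat.add_le_add (Nat.mul_le_mul_left _ (Nat.pow_le_pow_right (by omega) (by omega)))
      (Nat.mul_le_mul_left _ (Nat.pow_le_pow_right (by omega) (by omega)))
  | ite e c c' ih ih' =>
    obtain ⟨C₀, hC₀⟩ := halts_compileExp e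
    obtain ⟨C, D, hC⟩ := ih
    obtain ⟨C', D', hC'⟩ := ih'
    refine ⟨C₀ + (C + C' + 1), 2 + D + D', fun d B σ s Q hd hs h => Halts.mono (Halts.seq
      (T' := (C + C' + 1) * (B + 1) ^ (2 + D + D')) (hC₀ d B σ s hd hs h.1) fun s₁ h₁ => ?_) ?_
      fun _ h => h⟩
    · have hs₁ := hs.congr hd h₁.mem h₁.reg
      have hp := one B (2 + D + D')
      have hb : C * (B + 1) ^ D ≤ C * (B + 1) ^ (2 + D + D') :=
        Nat.mul_le_mul_left _ (Nat.pow_le_pow_right (by omega) (by omega))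
      have hb' : C' * (B + 1) ^ D' ≤ C' * (B + 1) ^ (2 + D + D') :=
        Nat.mul_le_mul_left _ (Nat.pow_le_pow_right (by omega) (by omega))
      simp only [add_mul, one_mul]
      by_cases h0 : e.eval σ = 0
      · obtain ⟨t, s', hx, ht, hq, hr⟩ := hC' d B σ s₁ Q hd hs₁ (h.2.2 h0)
        exact ⟨t + 1, s', .ite_false (by rw [h₁.val, h0]) hx, by omega, hq,
          fun k hk => (hr k hk).trans (h₁.reg _ (outside_tmp hk))⟩
      · obtain ⟨t, s', hx, ht, hq, hr⟩ := hC d B σ s₁ Q hd hs₁ (h.2.1 h0)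
        exact ⟨t + 1, s', .ite_true (by rwa [h₁.val]) hx, by omega, hq,
          fun k hk => (hr k hk).trans (h₁.reg _ (outside_tmp hk))⟩
    · rw [add_mul C₀]
      exact Nat.add_le_add_right
        (Nat.mul_le_mul_left _ (Nat.pow_le_pow_right (by omega) (by omega))) _
  | repeatFor x e c ih =>
    obtain ⟨C₀, hC₀⟩ := halts_compileExp e
    obtain ⟨C, D, hC⟩ := ih
    refine ⟨C₀ + (C + 8), D + 2, fun d B σ s Q hd hs h => Halts.mono (Halts.seq
      (hC₀ d B σ s hd hs h.1) fun s₁ h₁ => Halts.instr_seq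
      (T := (e.eval σ) * (C * (B + 1) ^ D + 6) + 1) ?_) ?_ fun _ h => h⟩
    · -- the counter `tmp (d + 1)` counts up from `0`, the counter `tmp d` down from the loop bound
      have key : ∀ m j (σ : Store V A) (s : State), Rep σ s → s.reg (tmp d) = m →
          s.reg (tmp (d + 1)) = j → wpLoop (wp B c) x Q m j σ →
          Halts (.loop (tmp d) (.seq (.instr (.const (varReg x) 0))
            (.seq (.instr (.add (varReg x) (varReg x) (tmp (d + 1))))
            (.seq (compile c (d + 2)) (.seq (.instr (.const (tmp (d + 2)) 1))
            (.seq (.instr (.add (tmp (d + 1)) (tmp (d + 1)) (tmp (d + 2))))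
            (.instr (.sub (tmp d) (tmp d) (tmp (d + 2)))))))))) s
            (m * (C * (B + 1) ^ D + 6) + 1) fun s' =>
            (∃ σ', Rep σ' s' ∧ Q σ') ∧ ∀ e < d, s'.reg (tmp e) = s.reg (tmp e) := by
        intro m
        induction m with
        | zero =>
          intro j σ s hs h0 _ h
          exact ⟨1, s, .loop_done h0, by omega, ⟨σ, hs, h⟩, fun _ _ => rfl⟩
        | succ m ihm =>
          intro j σ s hs h0 hj h
          obtain ⟨t, s', hx, ht, ⟨σ', hs', hq⟩, hr⟩ := hC (d + 2) B (σ.setVar x j)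
            ((Instr.add (varReg x) (varReg x) (tmp (d + 1))).apply
              ((Instr.const (varReg x) 0).apply s)) _ (by omega)
            (hs.setVar (d := d) hd (s' := (Instr.add (varReg x) (varReg x) (tmp (d + 1))).apply
              ((Instr.const (varReg x) 0).apply s)) rfl x j
              (by simp [Instr.apply,
                (outside_varReg 0 x (d + 1) (by omega)).symm, hj])
              (fun r hr hx => by simp [Instr.apply, hx])) h
          have hr' : ∀ k < d + 2, s'.reg (tmp k) = s.reg (tmp k) := fun k hk => by
            rw [hr k hk]
            simp [Instr.apply, (outside_varReg 0 x k (by omega)).symm]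
          have hd0 : 0 ≠ d := by omega
          obtain ⟨t', s'', hx', ht', hq', hr''⟩ := ihm (j + 1) σ'
            ((Instr.sub (tmp d) (tmp d) (tmp (d + 2))).apply
              ((Instr.add (tmp (d + 1)) (tmp (d + 1)) (tmp (d + 2))).apply
                ((Instr.const (tmp (d + 2)) 1).apply s')))
            (hs'.congr hd rfl (fun r hr => by
              simp [Instr.apply, hr d le_rfl, hr (d + 1) (by omega), hr (d + 2) (by omega)]))
            (by simp [Instr.apply, tmp_inj, hr' d (by omega), h0])
            (by simp [Instr.apply, tmp_inj, hr' (d + 1) (by omega), hj])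
            hq
          refine ⟨_, s'', .loop_step (by omega) (.seq (.instr _ _) (.seq (.instr _ _) (.seq hx
            (.seq (.instr _ _) (.seq (.instr _ _) (.instr _ _)))))) hx', ?_, hq', fun k hk => ?_⟩
          · rw [add_mul]
            omega
          · have h1 : k ≠ d := by omega
            have h2 : k ≠ d + 1 := by omega
            have h3 : k ≠ d + 2 := by omega
            rw [hr'' k hk]
            simp [Instr.apply, tmp_inj, h1, h2, h3, hr' k (by omega)]
      obtain ⟨t, s', hx, ht, hq, hr⟩ := key (e.eval σ) 0 σ
        ((Instr.const (tmp (d + 1)) 0).apply s₁)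
        ((hs.congr hd h₁.mem h₁.reg).congr hd rfl fun r hr => by
          simp [Instr.apply, hr (d + 1) (by omega)])
        (by simp [Instr.apply, tmp_inj, h₁.val])
        (by simp [Instr.apply]) h.2.2
      refine ⟨t, s', hx, ht, hq, fun k hk => ?_⟩
      have h2 : k ≠ d + 1 := by omega
      rw [hr k hk]
      simp [Instr.apply, tmp_inj, h2, h₁.reg _ (outside_tmp hk)]
    · have hN := h.2.1
      have h1 := one B D
      have h2 : (B + 1) ^ (D + 2) = (B + 1) ^ D * (B + 1) ^ 2 := pow_add _ _ _
      have h3 : C₀ * (B + 1) ^ 2 ≤ C₀ * (B + 1) ^ (D + 2) :=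
        Nat.mul_le_mul_left _ (Nat.pow_le_pow_right (by omega) (by omega))
      have h4 : e.eval σ * (C * (B + 1) ^ D + 6) ≤ (B + 1) ^ 2 * ((C + 6) * (B + 1) ^ D) :=
        Nat.mul_le_mul (by nlinarith) (by nlinarith)
      have h5 : (B + 1) ^ 2 * ((C + 6) * (B + 1) ^ D) = (C + 6) * (B + 1) ^ (D + 2) := by
        rw [h2]
        ring
      have h6 := one B (D + 2)
      simp only [add_mul] at *
      omega

end Compile

end BoundedLoop

/-! ### Directed Steiner trees -/

namespace Steiner

/-- There is a path from `v` to `w` that uses the edges in `F` only. -/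
def Reach (F : Finset (ℕ × ℕ)) (v w : ℕ) : Prop :=
  Relation.ReflTransGen (fun x y => (x, y) ∈ F) v w

theorem Reach.mono {F F' : Finset (ℕ × ℕ)} {v w : ℕ} (h : Reach F v w) (hF : F ⊆ F') :
    Reach F' v w :=
  Relation.ReflTransGen.mono (fun _ _ h => hF h) _ _ h

/-- The reversal of all edges. -/
def rev (F : Finset (ℕ × ℕ)) : Finset (ℕ × ℕ) := F.map (Equiv.prodComm ℕ ℕ).toEmbedding

@[simp] theorem mem_rev {F : Finset (ℕ × ℕ)} {p : ℕ × ℕ} : p ∈ rev F ↔ p.swap ∈ F := by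
  obtain ⟨a, b⟩ := p
  simp [rev]

@[simp] theorem card_rev (F : Finset (ℕ × ℕ)) : (rev F).card = F.card := Finset.card_map _

theorem rev_mono {F F' : Finset (ℕ × ℕ)} (h : F ⊆ F') : rev F ⊆ rev F' :=
  Finset.map_subset_map.2 h

theorem reach_rev {F : Finset (ℕ × ℕ)} {v w : ℕ} : Reach (rev F) v w ↔ Reach F w v := by
  unfold Reach
  rw [← Relation.reflTransGen_swap]
  simp

/-- If `v` has an edge in `F` to another vertex `u`, then `F` splits into that edge, a set `F₁` and
a set `F₂` such that each vertex that is reachable from `v` is reachable from `u` by `F₁` or from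
`v` by `F₂`. Here `F₁` are the edges that leave a vertex to which there is a path from `u` that
avoids `v`. -/
theorem exists_split {F : Finset (ℕ × ℕ)} {v u : ℕ} (he : (v, u) ∈ F) (huv : u ≠ v) :
    ∃ F₁ ⊆ F, ∃ F₂ ⊆ F, F₁.card + 1 + F₂.card = F.card ∧
      ∀ s, Reach F v s → Reach F₁ u s ∨ Reach F₂ v s := by
  classical
  set R : Set ℕ := {w | Reach (F.filter fun p => p.2 ≠ v) u w} with hR
  have hv : v ∉ R := by
    intro h
    rcases Relation.ReflTransGen.cases_tail h with h | ⟨w, _, h⟩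
    · exact huv h.symm
    · simp at h
  have hu : u ∈ R := Relation.ReflTransGen.refl
  have hstep : ∀ x y, x ∈ R → (x, y) ∈ F → y ≠ v → y ∈ R := fun x y hx hxy hy =>
    Relation.ReflTransGen.tail hx (by simp [hxy, hy])
  refine ⟨F.filter fun p => p.1 ∈ R, Finset.filter_subset _ _,
    (F.filter fun p => ¬ p.1 ∈ R).erase (v, u),
    (Finset.erase_subset _ _).trans (Finset.filter_subset _ _), ?_, fun s hs => ?_⟩
  · rw [add_assoc, add_comm 1, Finset.card_erase_add_one (by simp [he, hv]),
      Finset.card_filter_add_card_filter_not]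
  by_cases hsR : s ∈ R
  · left
    have : ∀ w, Reach (F.filter fun p => p.2 ≠ v) u w →
        Reach (F.filter fun p => p.1 ∈ R) u w := by
      intro w hw
      induction hw with
      | refl => exact .refl
      | tail h h' ih => exact ih.tail (Finset.mem_filter.2 ⟨(Finset.mem_filter.1 h').1, h⟩)
    exact this s hsR
  · right
    -- on a path from `v` to `s`, follow the part after the last visit to `v`: it avoids `R`
    have : ∀ x, Reach F x s → Reach ((F.filter fun p => ¬ p.1 ∈ R).erase (v, u)) v s ∨
        x ∉ R ∧ Reach ((F.filter fun p => ¬ p.1 ∈ R).erase (v, u)) x s := by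
      intro x hx
      induction hx using Relation.ReflTransGen.head_induction_on with
      | refl => exact Or.inr ⟨hsR, .refl⟩
      | @head x y hxy _ ih =>
        rcases ih with ih | ⟨hy, ih⟩
        · exact Or.inl ih
        by_cases hxR : x ∈ R
        · obtain rfl : y = v := by
            by_contra hne
            exact hy (hstep x y hxR hxy hne)
          exact Or.inl ih
        · refine Or.inr ⟨hxR, Relation.ReflTransGen.head ?_ ih⟩
          have : y ≠ u := fun h => hy (h ▸ hu)
          simp [hxy, hxR, this]
    rcases this v hs with h | h
    · exact h
    · exact h.2

/-- The numbers `a` and `b` code disjoint subsets of `{0, …, i - 1}`, as sums of powers of two. -/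
inductive DisjointCodes : ℕ → ℕ → ℕ → Prop
  | zero : DisjointCodes 0 0 0
  | none {i a b : ℕ} : DisjointCodes i a b → DisjointCodes (i + 1) a b
  | left {i a b : ℕ} : DisjointCodes i a b → DisjointCodes (i + 1) (a + 2 ^ i) b
  | right {i a b : ℕ} : DisjointCodes i a b → DisjointCodes (i + 1) a (b + 2 ^ i)

theorem DisjointCodes.add_lt {i a b : ℕ} (h : DisjointCodes i a b) : a + b < 2 ^ i := by
  induction h with
  | zero => simp
  | none _ ih => rw [pow_succ]; omega
  | left _ ih => rw [pow_succ]; omega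
  | right _ ih => rw [pow_succ]; omega

theorem testBit_add_two_pow {i a j : ℕ} (h : a < 2 ^ i) :
    (a + 2 ^ i).testBit j = (a.testBit j || decide (i = j)) := by
  have := Nat.two_pow_add_eq_or_of_lt h 1
  rw [mul_one] at this
  rw [add_comm, this, Nat.testBit_or, Nat.testBit_two_pow, Bool.or_comm]

theorem DisjointCodes.testBit_add {i a b : ℕ} (h : DisjointCodes i a b) (j : ℕ) :
    (a + b).testBit j = (a.testBit j || b.testBit j) := by
  induction h with
  | zero => simp
  | none _ ih => exact ih
  | @left i a b h ih =>
    have := h.add_lt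
    rw [add_right_comm, testBit_add_two_pow this, testBit_add_two_pow (by omega), ih,
      Bool.or_right_comm]
  | @right i a b h ih =>
    have := h.add_lt
    rw [← add_assoc, testBit_add_two_pow this, testBit_add_two_pow (by omega), ih, Bool.or_assoc]

/-- The splitting of a coded set by a property of its elements. -/
theorem exists_disjointCodes (p : ℕ → Prop) (i a : ℕ) (h : a < 2 ^ i) :
    ∃ b c, DisjointCodes i b c ∧ b + c = a ∧ (∀ j, b.testBit j → p j) ∧
      ∀ j, c.testBit j → ¬ p j := by
  induction i generalizing a with
  | zero =>
    obtain rfl : a = 0 := by simpa using h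
    exact ⟨0, 0, .zero, rfl, by simp, by simp⟩
  | succ i ih =>
    rw [pow_succ] at h
    by_cases ha : a < 2 ^ i
    · obtain ⟨b, c, h1, h2, h3, h4⟩ := ih a ha
      exact ⟨b, c, h1.none, h2, h3, h4⟩
    · obtain ⟨b, c, h1, h2, h3, h4⟩ := ih (a - 2 ^ i) (by omega)
      have := h1.add_lt
      by_cases hp : p i
      · refine ⟨b + 2 ^ i, c, h1.left, by omega, fun j hj => ?_, h4⟩
        rw [testBit_add_two_pow (by omega)] at hj
        rcases (by simpa using hj : b.testBit j = true ∨ i = j) with hj | rfl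
        · exact h3 j hj
        · exact hp
      · refine ⟨b, c + 2 ^ i, h1.right, by omega, h3, fun j hj => ?_⟩
        rw [testBit_add_two_pow (by omega)] at hj
        rcases (by simpa using hj : c.testBit j = true ∨ i = j) with hj | rfl
        · exact h4 j hj
        · exact hp

section Table
variable (G : Finset (ℕ × ℕ)) (τ : ℕ → ℕ) (n t : ℕ)

/-- All terminals `τ i` with `i` in the set coded by `a` are reachable from `v` by at most `c`
edges of `G`. -/
def Spans (v a c : ℕ) : Prop :=
  ∃ F ⊆ G, F.card ≤ c ∧ ∀ i, a.testBit i → Reach F v (τ i)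

/-- The entries of the table that are at most `k` are upper bounds for the cost of Steiner trees. -/
def Sound (k : ℕ) (D : ℕ → ℕ → ℕ) : Prop :=
  ∀ v < n, ∀ a < 2 ^ t, D v a ≤ k → Spans G τ v a (D v a)

/-- The entries of the table are lower bounds for the cost of Steiner trees of cost at most `ρ`. -/
def Complete (ρ : ℕ) (D : ℕ → ℕ → ℕ) : Prop :=
  ∀ F ⊆ G, F.card ≤ ρ → ∀ v < n, ∀ a < 2 ^ t, (∀ i, a.testBit i → Reach F v (τ i)) →
    D v a ≤ F.card

variable {G τ n t}

theorem Spans.mono {G' : Finset (ℕ × ℕ)} {v a c c' : ℕ} (h : Spans G τ v a c) (hG : G ⊆ G')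
    (hc : c ≤ c') : Spans G' τ v a c' := by
  obtain ⟨F, hF, hcard, h⟩ := h
  exact ⟨F, hF.trans hG, hcard.trans hc, h⟩

theorem spans_zero (v : ℕ) : Spans G τ v 0 0 := ⟨∅, by simp, by simp, by simp⟩

theorem spans_terminal (i : ℕ) : Spans G τ (τ i) (2 ^ i) 0 := by
  refine ⟨∅, by simp, by simp, fun j hj => ?_⟩
  obtain rfl : i = j := by simpa [Nat.testBit_two_pow] using hj
  exact .refl

theorem Spans.edge {v u a c : ℕ} (h : Spans G τ u a c) (he : (v, u) ∈ G) :
    Spans G τ v a (c + 1) := by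
  obtain ⟨F, hF, hcard, h⟩ := h
  refine ⟨insert (v, u) F, Finset.insert_subset he hF, (Finset.card_insert_le _ _).trans
    (by omega), fun i hi => Relation.ReflTransGen.head (Finset.mem_insert_self _ _)
    ((h i hi).mono (Finset.subset_insert _ _))⟩

theorem Spans.join {v i a b c d : ℕ} (h : Spans G τ v a c) (h' : Spans G τ v b d)
    (hab : DisjointCodes i a b) : Spans G τ v (a + b) (c + d) := by
  obtain ⟨F, hF, hcard, h⟩ := h
  obtain ⟨F', hF', hcard', h'⟩ := h'
  refine ⟨F ∪ F', Finset.union_subset hF hF', (Finset.card_union_le _ _).trans (by omega),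
    fun j hj => ?_⟩
  rw [hab.testBit_add] at hj
  rcases (by simpa using hj : a.testBit j = true ∨ b.testBit j = true) with hj | hj
  · exact (h j hj).mono Finset.subset_union_left
  · exact (h' j hj).mono Finset.subset_union_right

theorem Sound.update {k : ℕ} {D D' : ℕ → ℕ → ℕ} (h : Sound G τ n t k D)
    (hD : ∀ v < n, ∀ a < 2 ^ t, D' v a = D v a ∨ (D' v a ≤ k → Spans G τ v a (D' v a))) :
    Sound G τ n t k D' := by
  intro v hv a ha hk
  rcases hD v hv a ha with hD | hD
  · rw [hD] at hk ⊢
    exact h v hv a ha hk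
  · exact hD hk

/-- The empty set of edges spans, from `v`, only the empty set and `v` itself; as the terminals are
distinct, the codes of these sets are `0` and powers of two. -/
theorem complete_zero {D : ℕ → ℕ → ℕ} (hτ : Set.InjOn τ (Set.Iio t))
    (h0 : ∀ v < n, D v 0 = 0) (h1 : ∀ i < t, D (τ i) (2 ^ i) = 0) : Complete G τ n t 0 D := by
  intro F _ hcard v hv a ha hr
  obtain rfl : F = ∅ := by simpa using hcard
  have hr' : ∀ i, a.testBit i → τ i = v := by
    intro i hi
    rcases Relation.ReflTransGen.cases_head (hr i hi) with h | ⟨w, h, _⟩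
    · exact h.symm
    · simp at h
  have hlt : ∀ i, a.testBit i → i < t := by
    intro i hi
    by_contra hle
    rw [Nat.testBit_lt_two_pow (ha.trans_le (Nat.pow_le_pow_right (by omega) (by omega)))] at hi
    simp at hi
  by_cases ha0 : a = 0
  · simp [ha0, h0 v hv]
  · obtain ⟨i, hi⟩ := Nat.exists_testBit_of_ne_zero ha0
    have : a = 2 ^ i := by
      refine Nat.eq_of_testBit_eq fun j => ?_
      rw [Nat.testBit_two_pow]
      by_cases hij : i = j
      · subst hij
        simp [hi]
      · simp only [hij, decide_false]
        by_contra hj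
        rw [Bool.not_eq_false] at hj
        exact hij (hτ (hlt i hi) (hlt j hj) ((hr' i hi).trans (hr' j hj).symm))
    rw [this, ← hr' i hi, h1 i (hlt i hi)]
    simp

/-- One round of relaxations, `D₁` being the table after the relaxations along edges, accounts for
one more edge: split the edges at one that leaves `v`, relax along it, and join. -/
theorem Complete.succ {ρ : ℕ} {D D₁ D' : ℕ → ℕ → ℕ} (h : Complete G τ n t ρ D)
    (hG : ∀ e ∈ G, e.2 < n) (h₁ : ∀ v a, D₁ v a ≤ D v a)
    (h₁' : ∀ v u, (v, u) ∈ G → ∀ a < 2 ^ t, D₁ v a ≤ D u a + 1)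
    (h₂ : ∀ v a, D' v a ≤ D₁ v a)
    (h₂' : ∀ v < n, ∀ a b, DisjointCodes t a b → D' v (a + b) ≤ D₁ v a + D₁ v b) :
    Complete G τ n t (ρ + 1) D' := by
  intro F hF hcard v hv a ha hr
  by_cases hex : ∃ u, (v, u) ∈ F ∧ u ≠ v
  · obtain ⟨u, he, hu⟩ := hex
    obtain ⟨F₁, hF₁, F₂, hF₂, hsum, hsplit⟩ := exists_split he hu
    obtain ⟨b, c, hbc, rfl, hb, hc⟩ := exists_disjointCodes (fun i => Reach F₁ u (τ i)) t a ha
    have h3 : D u b ≤ F₁.card := h F₁ (hF₁.trans hF) (by omega) u (hG _ (hF he)) b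
      (by omega) hb
    have h4 : D v c ≤ F₂.card := h F₂ (hF₂.trans hF) (by omega) v hv c (by omega) fun i hi => by
      rcases hsplit _ (hr i (by simp [hbc.testBit_add, hi])) with h | h
      · exact (hc i hi h).elim
      · exact h
    have h5 := h₁' v u (hF he) b (by omega)
    have h6 := h₁ v c
    have h7 := h₂' v hv b c hbc
    omega
  · -- no edge leaves `v`, so the empty set of edges does the same
    have h3 : D v a ≤ (∅ : Finset (ℕ × ℕ)).card := by
      refine h ∅ (by simp) (by simp) v hv a ha fun i hi => ?_
      have : ∀ w, Reach F v w → w = v := by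
        intro w hw
        induction hw with
        | refl => rfl
        | tail _ h ih =>
          subst ih
          by_contra hne
          exact hex ⟨_, h, hne⟩
      rw [this _ (hr i hi)]
      exact .refl
    have h4 := h₁ v a
    have h5 := h₂ v a
    simp at h3
    omega

theorem Complete.le_iff {k : ℕ} {D : ℕ → ℕ → ℕ} (h : Complete G τ n t k D)
    (h' : Sound G τ n t k D) {v a : ℕ} (hv : v < n) (ha : a < 2 ^ t) :
    D v a ≤ k ↔ Spans G τ v a k := by
  refine ⟨fun hk => (h' v hv a ha hk).mono (Finset.Subset.refl _) hk, ?_⟩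
  rintro ⟨F, hF, hcard, hr⟩
  exact (h F hF hcard v hv a ha hr).trans hcard

end Table

/-! ### Minimal sets of edges -/

section Minimal
variable (τ : ℕ → ℕ) (t r k : ℕ)

/-- The graph `G` has a set of at most `k` edges by which the root `r` reaches all terminals, and
a set of at most `k` edges by which all terminals reach `r`. -/
def Good (G : Finset (ℕ × ℕ)) : Prop :=
  Spans G τ r (2 ^ t - 1) k ∧ Spans (rev G) τ r (2 ^ t - 1) k

variable {τ t r k}

theorem Good.mono {G G' : Finset (ℕ × ℕ)} (h : Good τ t r k G) (hG : G ⊆ G') :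
    Good τ t r k G' :=
  ⟨h.1.mono hG le_rfl, h.2.mono (rev_mono hG) le_rfl⟩

theorem spans_all_iff {G : Finset (ℕ × ℕ)} :
    Spans G τ r (2 ^ t - 1) k ↔ ∃ F ⊆ G, F.card ≤ k ∧ ∀ i < t, Reach F r (τ i) := by
  simp [Spans, Nat.testBit_two_pow_sub_one]

theorem Good.reach {G : Finset (ℕ × ℕ)} (h : Good τ t r k G) {i j : ℕ} (hi : i < t) (hj : j < t) :
    Reach G (τ i) (τ j) := by
  obtain ⟨F, hF, _, h1⟩ := spans_all_iff.1 h.1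
  obtain ⟨F', hF', _, h2⟩ := spans_all_iff.1 h.2
  exact Relation.ReflTransGen.trans (reach_rev.1 ((h2 i hi).mono hF')) ((h1 j hj).mono hF)

/-- A minimal set of edges with the property is the union of two sets of at most `k` edges. -/
theorem Good.card_le {G : Finset (ℕ × ℕ)} (h : Good τ t r k G)
    (hmin : ∀ e ∈ G, ¬ Good τ t r k (G.erase e)) : G.card ≤ 2 * k := by
  obtain ⟨F, hF, hc, h1⟩ := spans_all_iff.1 h.1
  obtain ⟨F', hF', hc', h2⟩ := spans_all_iff.1 h.2
  have hsub : G ⊆ F ∪ rev F' := by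
    intro e he
    by_contra hne
    rw [Finset.mem_union, not_or] at hne
    refine hmin e he ⟨spans_all_iff.2 ⟨F, ?_, hc, h1⟩, spans_all_iff.2 ⟨F', ?_, hc', h2⟩⟩
    · exact fun x hx => Finset.mem_erase.2 ⟨fun h => hne.1 (h ▸ hx), hF hx⟩
    · intro x hx
      have := mem_rev.1 (hF' hx)
      refine mem_rev.2 (Finset.mem_erase.2 ⟨fun h => hne.2 ?_, this⟩)
      rw [← h]
      simpa using hx
  have := (Finset.card_le_card hsub).trans (Finset.card_union_le _ _)
  rw [card_rev] at this
  omega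

theorem good_of_reach {G F : Finset (ℕ × ℕ)} (hF : F ⊆ G) (hc : F.card ≤ k)
    (h : ∀ i < t, Reach F r (τ i) ∧ Reach F (τ i) r) : Good τ t r k G :=
  ⟨spans_all_iff.2 ⟨F, hF, hc, fun i hi => (h i hi).1⟩,
    spans_all_iff.2 ⟨rev F, rev_mono hF, by simpa using hc, fun i hi => reach_rev.2 (h i hi).2⟩⟩

/-- A set of `c` edges reaches at most `c + 1` vertices. -/
theorem card_le_of_reach {F : Finset (ℕ × ℕ)} {T : Finset ℕ} (h : ∀ s ∈ T, Reach F r s) :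
    T.card ≤ F.card + 1 := by
  have : T ⊆ insert r (F.image Prod.snd) := by
    intro s hs
    rcases Relation.ReflTransGen.cases_tail (h s hs) with h | ⟨w, _, h⟩
    · simp [h]
    · exact Finset.mem_insert_of_mem (Finset.mem_image.2 ⟨_, h, rfl⟩)
  exact (Finset.card_le_card this).trans ((Finset.card_insert_le _ _).trans
    (Nat.add_le_add_right Finset.card_image_le 1))

end Minimal

end Steiner

/-! ### Reading the input and listing disjoint sets -/

namespace SteinerProgram

open BoundedLoop Steiner

/-- The variables of the program: `k` is the budget (and in the end the length of the output), `n`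
the number of vertices, `t` the number of terminals, `r` the root, `w` the number of codes of sets
of terminals, and `m` the number of pairs of codes of disjoint sets. As `k` comes first, it is kept
in the register `0`, where the machine expects the budget and the length of the output. -/
inductive Var
  | k | n | t | r | w | m | p | x | y | z | i | j | s | v | u | a | v₀ | u₀ | b₁ | b₂
  deriving DecidableEq

/-- The arrays of the program: the adjacency matrix `edge`, the list `term` of the terminals, the
pairs `(left, right)` of codes of disjoint sets, and the table `dist`. -/
inductive Arr
  | edge | term | left | right | dist
  deriving DecidableEq

instance : Numbered Var where
  num := Var.ctorIdx
  num_injective c d h := by cases c <;> cases d <;> first | rfl | cases h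

instance : Numbered Arr where
  num := Arr.ctorIdx
  num_injective c d h := by cases c <;> cases d <;> first | rfl | cases h

open Exp Cmd

/-- Finds the number of leading ones of the input: `n` is increased until it is the position of the
first zero, and stays there. -/
def readSize : Cmd Var Arr :=
  repeatFor .i len (ite (raw (var .n)) (set .n (add (var .n) (lit 1))) skip)

theorem wp_readSize {B N : ℕ} {σ : Store Var Arr} (hn : σ.var .n = 0) (hB : σ.len ≤ B)
    (hN : N < σ.len) (h1 : ∀ i < N, σ.raw i ≠ 0) (h0 : σ.raw N = 0) :
    wp B readSize (fun τ => τ.var .n = N) σ := by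
  refine wp_repeatFor (fun j τ => τ.var .n = min j N) σ.len trivial rfl hB (by simp [hn]) ?_ ?_
  · intro j hj τ hτ h
    have hr : τ.raw = σ.raw := hτ.raw (by simp [Cmd.modRaw])
    simp only [wp, Exp.Ok, Exp.eval, Store.setVar_var, Store.setVar_raw, Store.setVar_len, h, hr,
      hτ.len, reduceCtorEq, if_false, if_true, true_and]
    refine ⟨by omega, fun h => ?_, fun h => ?_⟩
    · have : ¬ N ≤ j := fun hle => h (by rw [Nat.min_eq_right hle, h0])
      omega
    · have : ¬ j < N := fun hlt => h1 j hlt (by rwa [Nat.min_eq_left hlt.le] at h)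
      omega
  · intro τ _ h
    rw [h]
    omega

/-- Reads the adjacency matrix. -/
def readEdges : Cmd Var Arr :=
  set .p (add (var .n) (lit 1)) ;;
  repeatFor .v (var .n) (repeatFor .u (var .n)
    (putArr .edge (var .v) (var .u) (raw (var .p)) ;; set .p (add (var .p) (lit 1))))

theorem index_lt {N j l : ℕ} (hj : j < N) (hl : l < N) : j * N + l < N * N :=
  calc j * N + l < (j + 1) * N := by rw [add_mul]; omega
    _ ≤ N * N := Nat.mul_le_mul_right _ hj

theorem wp_readEdges {B N : ℕ} {σ : Store Var Arr} (hn : σ.var .n = N) (hB : N ≤ B)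
    (hN : N + 1 + N * N ≤ σ.len) :
    wp B readEdges (fun τ => τ.var .p = N + 1 + N * N ∧
      ∀ v < N, ∀ u < N, τ.arr .edge v u = σ.raw (N + 1 + (v * N + u))) σ := by
  refine ⟨⟨trivial, trivial⟩, ?_⟩
  refine wp_repeatFor (fun j τ => τ.var .p = N + 1 + j * N ∧
      ∀ v < j, ∀ u < N, τ.arr .edge v u = σ.raw (N + 1 + (v * N + u))) N trivial
    (by simp [Exp.eval, hn]) hB (by simp [Exp.eval, hn]) ?_ fun _ _ h => h
  rintro j hj τ hτ ⟨hp, he⟩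
  have hn' : τ.var .n = N := by simpa [hn] using hτ.var .n (by simp [Cmd.modVar])
  have hr : τ.raw = σ.raw := hτ.raw (by simp [Cmd.modRaw])
  refine wp_repeatFor (fun l τ => τ.var .p = N + 1 + (j * N + l) ∧
      ∀ v < N, ∀ u < N, v < j ∨ v = j ∧ u < l → τ.arr .edge v u = σ.raw (N + 1 + (v * N + u)))
    N trivial (by simp [Exp.eval, hn']) hB ?_ ?_ ?_
  · refine ⟨by simpa using hp, fun v _ u hu h => he v ?_ u hu⟩
    omega
  · rintro l hl τ' hτ' ⟨hp', he'⟩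
    have hv : τ'.var .v = j := by simpa using hτ'.var .v (by simp [Cmd.modVar])
    have hr' : τ'.raw = σ.raw := (hτ'.raw (by simp [Cmd.modRaw])).trans hr
    have hl' : τ'.len = σ.len := hτ'.len.trans hτ.len
    have := index_lt hj hl
    simp only [wp, Exp.Ok, Exp.eval, Store.setVar_var, Store.setVar_raw, Store.setVar_len, hv, hr',
      hl', hp', reduceCtorEq, if_false, if_true, true_and, Store.setArr_var, Store.setArr_arr,
      Store.setVar_arr]
    refine ⟨by omega, by omega, by omega, by omega, fun v hv u hu h => ?_⟩
    split_ifs with h'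
    · rw [h'.1, h'.2]
    · exact he' v hv u hu (by omega)
  · rintro τ' - ⟨hp', he'⟩
    refine ⟨by rw [hp']; ring, fun v hv u hu => he' v (by omega) u hu (by omega)⟩

/-- Reads the terminals; the last one becomes the root. -/
def readTerminals : Cmd Var Arr :=
  repeatFor .v (var .n)
    (ite (raw (var .p))
      (putArr .term (lit 0) (var .t) (var .v) ;; set .r (var .v) ;;
        set .t (add (var .t) (lit 1))) skip ;;
    set .p (add (var .p) (lit 1)))

/-- The numbers `τ 0, …, τ (t - 1)` are the elements of the set `T`, without repetition. -/
structure Lists (τ : ℕ → ℕ) (t : ℕ) (T : ℕ → Prop) : Prop where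
  inj : Set.InjOn τ (Set.Iio t)
  mem : ∀ i < t, T (τ i)
  exists_eq : ∀ v, T v → ∃ i < t, τ i = v

theorem Lists.snoc {f g : ℕ → ℕ} {t j : ℕ} {P : ℕ → Prop} (h : Lists f t fun v => v < j ∧ P v)
    (hj : P j) (hg : ∀ i < t, g i = f i) (hgt : g t = j) :
    Lists g (t + 1) fun v => v < j + 1 ∧ P v where
  inj i hi i' hi' heq := by
    rw [Set.mem_Iio] at hi hi'
    rcases Nat.lt_succ_iff_lt_or_eq.1 hi with h1 | rfl <;>
      rcases Nat.lt_succ_iff_lt_or_eq.1 hi' with h2 | rfl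
    · rw [hg i h1, hg i' h2] at heq
      exact h.inj h1 h2 heq
    · have := (h.mem i h1).1
      rw [hg i h1, hgt] at heq
      omega
    · have := (h.mem i' h2).1
      rw [hg i' h2, hgt] at heq
      omega
    · rfl
  mem i hi := by
    rcases Nat.lt_succ_iff_lt_or_eq.1 hi with h1 | rfl
    · rw [hg i h1]
      exact ⟨(h.mem i h1).1.trans (Nat.lt_succ_self j), (h.mem i h1).2⟩
    · rw [hgt]
      exact ⟨Nat.lt_succ_self j, hj⟩
  exists_eq v hv := by
    by_cases hvj : v = j
    · exact ⟨t, Nat.lt_succ_self t, hvj ▸ hgt⟩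
    · obtain ⟨i, hi, rfl⟩ := h.exists_eq v ⟨by omega, hv.2⟩
      exact ⟨i, hi.trans (Nat.lt_succ_self t), hg i hi⟩

theorem wp_readTerminals {B N : ℕ} {σ : Store Var Arr} (hn : σ.var .n = N) (hB : N ≤ B)
    (ht : σ.var .t = 0) (hr₀ : σ.var .r = 0) (hp : σ.var .p = N + 1 + N * N)
    (hN : N + 1 + N * N + N ≤ σ.len) :
    wp B readTerminals (fun τ =>
      Lists (τ.arr .term 0) (τ.var .t) (fun v => v < N ∧ σ.raw (N + 1 + N * N + v) ≠ 0) ∧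
      (τ.var .t = 0 → τ.var .r = 0) ∧
      (0 < τ.var .t → ∃ i < τ.var .t, τ.arr .term 0 i = τ.var .r)) σ := by
  refine wp_repeatFor (fun j τ => τ.var .p = N + 1 + N * N + j ∧ τ.var .t ≤ j ∧
      Lists (τ.arr .term 0) (τ.var .t) (fun v => v < j ∧ σ.raw (N + 1 + N * N + v) ≠ 0) ∧
      (τ.var .t = 0 → τ.var .r = 0) ∧
      (0 < τ.var .t → ∃ i < τ.var .t, τ.arr .term 0 i = τ.var .r)) N trivial
    (by simp [Exp.eval, hn]) hB ?_ ?_ fun τ _ h => h.2.2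
  · refine ⟨hp, by omega, ⟨?_, ?_, ?_⟩, ?_, ?_⟩ <;> simp [ht, hr₀]
  rintro j hj τ hτ ⟨hp', ht', hL, hr⟩
  have hraw : τ.raw = σ.raw := hτ.raw (by simp [Cmd.modRaw])
  simp only [wp, Exp.Ok, Exp.eval, Store.setVar_var, Store.setVar_raw, Store.setVar_len, hraw,
    hτ.len, hp', reduceCtorEq, if_false, if_true, true_and, Store.setArr_var, Store.setArr_arr,
    Store.setVar_arr]
  refine ⟨by omega, fun h => ⟨by omega, by omega, by omega, by omega, hL.snoc h ?_ ?_,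
    fun h => h.elim, ?_⟩,
    fun h => ⟨by omega, by omega, ⟨hL.inj, ?_, ?_⟩, hr⟩⟩
  · intro i hi
    simp [hi.ne]
  · simp
  · exact fun _ => ⟨τ.var .t, by omega, by simp⟩
  · intro i hi
    have := hL.mem i hi
    exact ⟨by omega, this.2⟩
  · rintro v ⟨hv, hv'⟩
    refine hL.exists_eq v ⟨?_, hv'⟩
    by_contra hle
    obtain rfl : v = j := by omega
    exact hv' h

/-- Lists the pairs of codes of disjoint sets of terminals, and computes the number of codes. -/
def makePairs : Cmd Var Arr :=
  set .w (lit 1) ;; set .m (lit 1) ;; putArr .left (lit 0) (lit 0) (lit 0) ;;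
  putArr .right (lit 0) (lit 0) (lit 0) ;;
  repeatFor .i (var .t)
    (repeatFor .j (var .m)
      (set .y (arr .left (lit 0) (var .j)) ;; set .z (arr .right (lit 0) (var .j)) ;;
      putArr .left (lit 0) (var .m) (add (var .y) (var .w)) ;;
      putArr .right (lit 0) (var .m) (var .z) ;;
      set .m (add (var .m) (lit 1)) ;;
      putArr .left (lit 0) (var .m) (var .y) ;;
      putArr .right (lit 0) (var .m) (add (var .z) (var .w)) ;;
      set .m (add (var .m) (lit 1))) ;;
    set .w (add (var .w) (var .w)))

/-- The pairs `(f p, g p)` with `p < m` are the pairs of codes of disjoint subsets of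
`{0, …, i - 1}`. -/
structure ListsPairs (i m : ℕ) (f g : ℕ → ℕ) : Prop where
  mem : ∀ p < m, DisjointCodes i (f p) (g p)
  exists_eq : ∀ a b, DisjointCodes i a b → ∃ p < m, f p = a ∧ g p = b

/-- An element `i` may belong to none of the sets, to the first, or to the second one. -/
theorem ListsPairs.succ {i m : ℕ} {f g f' g' : ℕ → ℕ} (h : ListsPairs i m f g)
    (h₀ : ∀ p < m, f' p = f p ∧ g' p = g p)
    (h₁ : ∀ p < m, f' (m + 2 * p) = f p + 2 ^ i ∧ g' (m + 2 * p) = g p)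
    (h₂ : ∀ p < m, f' (m + 2 * p + 1) = f p ∧ g' (m + 2 * p + 1) = g p + 2 ^ i) :
    ListsPairs (i + 1) (3 * m) f' g' where
  mem q hq := by
    by_cases hqm : q < m
    · rw [(h₀ q hqm).1, (h₀ q hqm).2]
      exact (h.mem q hqm).none
    · obtain ⟨p, hp⟩ : ∃ p, q = m + 2 * p ∨ q = m + 2 * p + 1 := ⟨(q - m) / 2, by omega⟩
      have hpm : p < m := by omega
      rcases hp with rfl | rfl
      · rw [(h₁ p hpm).1, (h₁ p hpm).2]
        exact (h.mem p hpm).left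
      · rw [(h₂ p hpm).1, (h₂ p hpm).2]
        exact (h.mem p hpm).right
  exists_eq a b hab := by
    cases hab with
    | none hab =>
      obtain ⟨p, hp, rfl, rfl⟩ := h.exists_eq _ _ hab
      exact ⟨p, by omega, h₀ p hp⟩
    | left hab =>
      obtain ⟨p, hp, rfl, rfl⟩ := h.exists_eq _ _ hab
      exact ⟨m + 2 * p, by omega, h₁ p hp⟩
    | right hab =>
      obtain ⟨p, hp, rfl, rfl⟩ := h.exists_eq _ _ hab
      exact ⟨m + 2 * p + 1, by omega, h₂ p hp⟩

theorem wp_makePairs {B t : ℕ} {σ : Store Var Arr} (ht : σ.var .t = t) (htB : t ≤ B)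
    (hB : 3 ^ t ≤ B) :
    wp B makePairs (fun τ => τ.var .w = 2 ^ t ∧ τ.var .m = 3 ^ t ∧
      ListsPairs t (3 ^ t) (τ.arr .left 0) (τ.arr .right 0)) σ := by
  refine ⟨trivial, trivial, ⟨trivial, trivial, trivial⟩, by simp [Exp.eval], by simp [Exp.eval],
    ⟨trivial, trivial, trivial⟩, by simp [Exp.eval], by simp [Exp.eval], ?_⟩
  refine wp_repeatFor (fun i τ => τ.var .w = 2 ^ i ∧ τ.var .m = 3 ^ i ∧
      ListsPairs i (3 ^ i) (τ.arr .left 0) (τ.arr .right 0)) t trivial (by simp [Exp.eval, ht]) htB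
    ⟨by simp [Exp.eval], by simp [Exp.eval], ⟨?_, ?_⟩⟩ ?_ fun _ _ h => h
  · intro p hp
    obtain rfl : p = 0 := by simpa using hp
    simpa [Exp.eval] using DisjointCodes.zero
  · intro a b hab
    cases hab
    exact ⟨0, by simp, by simp [Exp.eval]⟩
  rintro i hi τ hτ ⟨hw, hm, hL⟩
  have h3 : 3 * 3 ^ i ≤ B := by
    rw [← pow_succ']
    exact (Nat.pow_le_pow_right (by omega) hi).trans hB
  generalize hM : 3 ^ i = M at *
  refine wp_repeatFor (fun l τ' => τ'.var .m = M + 2 * l ∧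
      (∀ p < M, τ'.arr .left 0 p = τ.arr .left 0 p ∧ τ'.arr .right 0 p = τ.arr .right 0 p) ∧
      (∀ p < l, τ'.arr .left 0 (M + 2 * p) = τ.arr .left 0 p + 2 ^ i ∧
        τ'.arr .right 0 (M + 2 * p) = τ.arr .right 0 p) ∧
      ∀ p < l, τ'.arr .left 0 (M + 2 * p + 1) = τ.arr .left 0 p ∧
        τ'.arr .right 0 (M + 2 * p + 1) = τ.arr .right 0 p + 2 ^ i) M trivial
    (by simp [Exp.eval, hm]) (by omega) (by simp [hm]) ?_ ?_
  · rintro l hl τ' hτ' ⟨hm', h0, h1, h2⟩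
    have hw' : τ'.var .w = 2 ^ i := by simpa [hw] using hτ'.var .w (by simp [Cmd.modVar])
    simp only [wp, Exp.Ok, Exp.eval, Store.setVar_var, hm', (h0 l hl).1, (h0 l hl).2, hw',
      reduceCtorEq, if_false, if_true, true_and, false_and, Store.setArr_var, Store.setArr_arr,
      Store.setVar_arr]
    refine ⟨by omega, by omega, by omega, by omega, by omega, by omega, by omega, by omega,
      by omega, by omega, by omega, fun p hp => ?_, fun p hp => ?_, fun p hp => ?_⟩
    · rw [if_neg (by omega), if_neg (by omega), if_neg (by omega), if_neg (by omega)]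
      exact h0 p hp
    · by_cases hpl : p = l
      · subst hpl
        simp
      · rw [if_neg (by omega), if_neg (by omega), if_neg (by omega), if_neg (by omega)]
        exact h1 p (by omega)
    · by_cases hpl : p = l
      · subst hpl
        simp
      · rw [if_neg (by omega), if_neg (by omega), if_neg (by omega), if_neg (by omega)]
        exact h2 p (by omega)
  · rintro τ' hτ' ⟨hm', h0, h1, h2⟩
    have hw' : τ'.var .w = 2 ^ i := by simpa [hw] using hτ'.var .w (by simp [Cmd.modVar])
    refine ⟨⟨trivial, trivial⟩, ?_, ?_, ?_⟩
    · simp [Exp.eval, hw', pow_succ]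
      ring
    · simp [hm', pow_succ, hM]
      ring
    · rw [pow_succ', hM]
      exact hL.succ h0 h1 h2

/-! ### The table of costs of Steiner trees -/

/-- The data of an instance that the program keeps while it computes tables. -/
structure Params where
  N : ℕ
  t : ℕ
  r : ℕ
  k : ℕ
  τ : ℕ → ℕ
  left : ℕ → ℕ
  right : ℕ → ℕ

/-- The bounds and the correctness of the data of an instance. -/
structure Params.Valid (P : Params) (B : ℕ) : Prop where
  N_le : P.N ≤ B
  k_le : P.k ≤ B
  t_le : P.t ≤ B
  two_le : 2 ^ P.t ≤ B
  three_le : 3 ^ P.t ≤ B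
  r_lt : P.r < P.N
  τ_lt : ∀ i < P.t, P.τ i < P.N
  τ_inj : Set.InjOn P.τ (Set.Iio P.t)
  pairs : ListsPairs P.t (3 ^ P.t) P.left P.right

/-- The store holds the data of the instance. -/
structure Holds (P : Params) (σ : Store Var Arr) : Prop where
  n : σ.var .n = P.N
  t : σ.var .t = P.t
  r : σ.var .r = P.r
  k : σ.var .k = P.k
  w : σ.var .w = 2 ^ P.t
  m : σ.var .m = 3 ^ P.t
  term : σ.arr .term 0 = P.τ
  left : σ.arr .left 0 = P.left
  right : σ.arr .right 0 = P.right

theorem Holds.congr {P : Params} {σ σ' : Store Var Arr} (h : Holds P σ)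
    (hv : ∀ q ∈ [Var.n, .t, .r, .k, .w, .m], σ'.var q = σ.var q)
    (ha : ∀ a ∈ [Arr.term, .left, .right], σ'.arr a = σ.arr a) : Holds P σ' where
  n := (hv _ (by simp)).trans h.n
  t := (hv _ (by simp)).trans h.t
  r := (hv _ (by simp)).trans h.r
  k := (hv _ (by simp)).trans h.k
  w := (hv _ (by simp)).trans h.w
  m := (hv _ (by simp)).trans h.m
  term := by rw [ha _ (by simp), h.term]
  left := by rw [ha _ (by simp), h.left]
  right := by rw [ha _ (by simp), h.right]

theorem Holds.agree {P : Params} {c : Cmd Var Arr} {σ σ' : Store Var Arr} (h : Holds P σ)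
    (hc : Agree c σ σ') (hv : ∀ q ∈ [Var.n, .t, .r, .k, .w, .m], ¬ c.modVar q)
    (ha : ∀ a ∈ [Arr.term, .left, .right], ¬ c.modArr a) : Holds P σ' :=
  h.congr (fun _ hx => hc.var _ (hv _ hx)) (fun _ hx => hc.arr _ (ha _ hx))

theorem Holds.setVar {P : Params} {σ : Store Var Arr} (h : Holds P σ) (q : Var) (c : ℕ)
    (hq : q ∉ [Var.n, .t, .r, .k, .w, .m]) : Holds P (σ.setVar q c) := by
  refine h.congr (fun q' hq' => ?_) fun _ _ => rfl
  have : q' ≠ q := fun h => hq (h ▸ hq')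
  simp [this]

/-- The edges given by an adjacency matrix. -/
def graphOf (N : ℕ) (e : ℕ → ℕ → ℕ) : Finset (ℕ × ℕ) :=
  (Finset.range N ×ˢ Finset.range N).filter fun p => e p.1 p.2 ≠ 0

theorem mem_graphOf {N : ℕ} {e : ℕ → ℕ → ℕ} {v u : ℕ} :
    (v, u) ∈ graphOf N e ↔ (v < N ∧ u < N) ∧ e v u ≠ 0 := by
  simp [graphOf]

/-- The graph itself, or the graph with all edges reversed. -/
def orient (out : Bool) (G : Finset (ℕ × ℕ)) : Finset (ℕ × ℕ) := if out then G else rev G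

/-- The test whether `(v, u)` is an edge of the graph or of its reversal. -/
def edgeTest (out : Bool) : Exp Var Arr :=
  if out then arr .edge (var .v) (var .u) else arr .edge (var .u) (var .v)

theorem edgeTest_ok {B : ℕ} {out : Bool} {σ : Store Var Arr} (hv : σ.var .v ≤ B)
    (hu : σ.var .u ≤ B) : (edgeTest out).Ok B σ := by
  cases out <;> simp [edgeTest, Exp.Ok, Exp.eval, hv, hu]

theorem eval_edgeTest {N : ℕ} {out : Bool} {σ : Store Var Arr} (hv : σ.var .v < N)
    (hu : σ.var .u < N) : (edgeTest out).eval σ ≠ 0 ↔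
      (σ.var .v, σ.var .u) ∈ orient out (graphOf N (σ.arr .edge)) := by
  cases out <;> simp [edgeTest, Exp.eval, orient, mem_graphOf, hv, hu]

theorem orient_lt {N : ℕ} {out : Bool} {e : ℕ → ℕ → ℕ} {p : ℕ × ℕ}
    (h : p ∈ orient out (graphOf N e)) : p.1 < N ∧ p.2 < N := by
  obtain ⟨v, u⟩ := p
  cases out
  · simp only [orient, Bool.false_eq_true, if_false, mem_rev, Prod.swap_prod_mk, mem_graphOf] at h
    exact h.1.symm
  · simp only [orient, if_true, mem_graphOf] at h
    exact h.1

/-- The initial table: the empty set and the singletons of terminals have cost `0`. -/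
def initTable : Cmd Var Arr :=
  repeatFor .v (var .n)
    (repeatFor .a (var .w) (putArr .dist (var .v) (var .a) (add (var .k) (lit 1))) ;;
    putArr .dist (var .v) (lit 0) (lit 0)) ;;
  set .x (lit 1) ;;
  repeatFor .i (var .t)
    (putArr .dist (arr .term (lit 0) (var .i)) (var .x) (lit 0) ;; set .x (add (var .x) (var .x)))

theorem wp_initTable {B : ℕ} {P : Params} (hP : P.Valid B) {σ : Store Var Arr} (h : Holds P σ)
    (G : Finset (ℕ × ℕ)) :
    wp B initTable (fun σ' => Sound G P.τ P.N P.t P.k (σ'.arr .dist) ∧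
      Complete G P.τ P.N P.t 0 (σ'.arr .dist)) σ := by
  have hN := hP.N_le
  have hw := hP.two_le
  have hpos : 0 < 2 ^ P.t := by positivity
  refine wp_repeatFor (fun j σ' => ∀ v < j, σ'.arr .dist v 0 = 0 ∧
      ∀ a < 2 ^ P.t, σ'.arr .dist v a ≤ P.k → Spans G P.τ v a (σ'.arr .dist v a))
    P.N trivial (by simp [Exp.eval, h.n]) hN (by simp) ?_ ?_
  · intro j hj σ₁ hσ₁ h₁
    have hh₁ := h.agree hσ₁ (by simp [Cmd.modVar]) (by simp [Cmd.modArr])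
    refine wp_repeatFor (fun b σ' => (∀ v < j, σ'.arr .dist v 0 = 0 ∧
        ∀ a < 2 ^ P.t, σ'.arr .dist v a ≤ P.k → Spans G P.τ v a (σ'.arr .dist v a)) ∧
        ∀ a < b, σ'.arr .dist j a = P.k + 1) (2 ^ P.t) trivial (by simp [Exp.eval, hh₁.w]) hw
      ⟨by simpa using h₁, by simp⟩ ?_ ?_
    · rintro b hb σ₂ hσ₂ ⟨h₂, h₂'⟩
      have hk : σ₂.var .k = P.k := by simpa [hh₁.k] using hσ₂.var .k (by simp [Cmd.modVar])
      have hv : σ₂.var .v = j := by simpa using hσ₂.var .v (by simp [Cmd.modVar])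
      simp only [wp, Exp.Ok, Exp.eval, Store.setVar_var, hk, hv, reduceCtorEq, if_false, if_true,
        true_and, Store.setArr_arr, Store.setVar_arr]
      refine ⟨by omega, by omega, fun v hv => ?_, fun a ha => ?_⟩
      · simp only [hv.ne, false_and, if_false]
        exact h₂ v hv
      · split_ifs with hab
        · rfl
        · exact h₂' a (by omega)
    · rintro σ₂ hσ₂ ⟨h₂, h₂'⟩
      have hv : σ₂.var .v = j := by simpa using hσ₂.var .v (by simp [Cmd.modVar])
      simp only [wp, Exp.Ok, Exp.eval, hv, true_and, Store.setArr_arr]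
      refine ⟨by omega, by omega, fun v hv => ?_⟩
      by_cases hvj : v = j
      · subst hvj
        simp only [true_and, and_self, if_true]
        intro a ha
        split_ifs with ha0
        · subst ha0
          exact fun _ => spans_zero v
        · rw [h₂' a ha]
          intro
          omega
      · simp only [hvj, false_and, if_false]
        exact h₂ v (by omega)
  · intro σ₁ hσ₁ h₁
    have hh₁ := h.agree hσ₁ (by simp [Cmd.modVar]) (by simp [Cmd.modArr])
    refine ⟨trivial, wp_repeatFor (fun i σ' => σ'.var .x = 2 ^ i ∧
      Sound G P.τ P.N P.t P.k (σ'.arr .dist) ∧ (∀ v < P.N, σ'.arr .dist v 0 = 0) ∧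
      ∀ l < i, σ'.arr .dist (P.τ l) (2 ^ l) = 0)
      P.t trivial (by simp [Exp.eval, hh₁.t]) hP.t_le
      ⟨by simp [Exp.eval], fun v hv a ha => (h₁ v hv).2 a ha, fun v hv => (h₁ v hv).1, by simp⟩
      ?_ ?_⟩
    · rintro i hi σ₂ hσ₂ ⟨hx, h₂, h₃, h₄⟩
      have hterm : σ₂.arr .term 0 = P.τ := by
        simpa [hh₁.term] using congrFun (hσ₂.arr .term (by simp [Cmd.modArr])) 0
      have h2i : 2 ^ i < 2 ^ P.t := Nat.pow_lt_pow_right (by omega) hi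
      have hτ := hP.τ_lt i hi
      have ht := hP.t_le
      simp only [wp, Exp.Ok, Exp.eval, Store.setVar_var, hx, hterm, reduceCtorEq, if_false,
        if_true, true_and, and_true, Store.setArr_var, Store.setArr_arr, Store.setVar_arr]
      refine ⟨⟨by omega, by omega⟩, by omega, by omega, by rw [pow_succ]; omega, ?_,
        fun v hv => ?_, fun l hl => ?_⟩
      · refine h₂.update fun v hv a ha => ?_
        by_cases hva : v = P.τ i ∧ a = 2 ^ i
        · simp only [hva, and_self, Store.setVar_arr, Store.setArr_arr, if_true]
          exact Or.inr fun _ => spans_terminal i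
        · left
          simp [hva]
      · split_ifs
        · rfl
        · exact h₃ v hv
      · split_ifs with hl'
        · rfl
        · refine h₄ l ?_
          by_contra hle
          obtain rfl : l = i := by omega
          exact hl' ⟨rfl, rfl⟩
    · rintro σ₂ _ ⟨_, h₂, h₃, h₄⟩
      exact ⟨h₂, complete_zero hP.τ_inj h₃ h₄⟩

/-- The relaxations along all edges. -/
def relaxEdges (out : Bool) : Cmd Var Arr :=
  repeatFor .v (var .n) (repeatFor .u (var .n) (ite (edgeTest out)
    (repeatFor .a (var .w) (set .x (add (arr .dist (var .u) (var .a)) (lit 1)) ;;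
      ite (sub (arr .dist (var .v) (var .a)) (var .x))
        (putArr .dist (var .v) (var .a) (var .x)) skip)) skip))

/-- The state of the relaxations of the table `D₀` along the edges: those that are described by
`done` are accomplished. The program updates the table in place; this does no harm, as its entries
only decrease. -/
structure EdgesDone (G : Finset (ℕ × ℕ)) (P : Params) (D₀ : ℕ → ℕ → ℕ)
    (done : ℕ → ℕ → ℕ → Prop) (D : ℕ → ℕ → ℕ) : Prop where
  le : ∀ v a, D v a ≤ D₀ v a
  sound : Sound G P.τ P.N P.t P.k D
  relaxed : ∀ v u, (v, u) ∈ G → ∀ a < 2 ^ P.t, done v u a → D v a ≤ D₀ u a + 1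

theorem EdgesDone.imp {G : Finset (ℕ × ℕ)} {P : Params} {D₀ D : ℕ → ℕ → ℕ}
    {done done' : ℕ → ℕ → ℕ → Prop} (h : EdgesDone G P D₀ done D)
    (hd : ∀ v u, (v, u) ∈ G → ∀ a < 2 ^ P.t, done' v u a → done v u a) :
    EdgesDone G P D₀ done' D :=
  ⟨h.le, h.sound, fun v u he a ha h' => h.relaxed v u he a ha (hd v u he a ha h')⟩

theorem wp_relaxEdges {B : ℕ} {P : Params} (hP : P.Valid B) {σ : Store Var Arr} (h : Holds P σ)
    (out : Bool) (G : Finset (ℕ × ℕ)) (hG : G = orient out (graphOf P.N (σ.arr .edge)))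
    (hs : Sound G P.τ P.N P.t P.k (σ.arr .dist)) :
    wp B (relaxEdges out) (fun σ' =>
      EdgesDone G P (σ.arr .dist) (fun _ _ _ => True) (σ'.arr .dist)) σ := by
  have hN := hP.N_le
  have hw := hP.two_le
  refine wp_repeatFor (fun j σ' => EdgesDone G P (σ.arr .dist) (fun v _ _ => v < j)
    (σ'.arr .dist)) P.N trivial (by simp [Exp.eval, h.n]) hN ⟨fun _ _ => le_rfl, hs, by simp⟩ ?_ ?_
  · intro j hj σ₁ hσ₁ h₁
    have hh₁ := h.agree hσ₁ (by simp [Cmd.modVar]) (by simp [Cmd.modArr])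
    refine wp_repeatFor (fun l σ' => EdgesDone G P (σ.arr .dist)
      (fun v u _ => v < j ∨ v = j ∧ u < l) (σ'.arr .dist)) P.N trivial
      (by simp [Exp.eval, hh₁.n]) hN (h₁.imp (by simp)) ?_ ?_
    · intro l hl σ₂ hσ₂ h₂
      have hh₂ := (hh₁.setVar .v j (by simp)).agree hσ₂ (by simp [Cmd.modVar])
        (by simp [Cmd.modArr])
      have hv₂ : σ₂.var .v = j := by simpa using hσ₂.var .v (by simp [Cmd.modVar])
      have he₂ : σ₂.arr .edge = σ.arr .edge :=
        (hσ₂.arr .edge (by simp [Cmd.modArr])).trans (hσ₁.arr .edge (by simp [Cmd.modArr]))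
      have hedge := eval_edgeTest (N := P.N) (out := out) (σ := σ₂.setVar .u l) (by simp [hv₂, hj])
        (by simp [hl])
      simp only [Store.setVar_var, Store.setVar_arr, he₂, hv₂, reduceCtorEq, if_false, if_true,
        ← hG] at hedge
      refine ⟨edgeTest_ok (by simp; omega) (by simp; omega), fun he => ?_, fun he => ?_⟩
      · rw [hedge] at he
        refine wp_repeatFor (fun b σ' => EdgesDone G P (σ.arr .dist)
          (fun v u a => v < j ∨ v = j ∧ (u < l ∨ u = l ∧ a < b)) (σ'.arr .dist)) (2 ^ P.t) trivial
          (by simp [Exp.eval, hh₂.w]) hw (h₂.imp (by simp)) ?_ ?_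
        · intro b hb σ₃ hσ₃ h₃
          have hv₃ : σ₃.var .v = j := by simpa [hv₂] using hσ₃.var .v (by simp [Cmd.modVar])
          have hu₃ : σ₃.var .u = l := by simpa using hσ₃.var .u (by simp [Cmd.modVar])
          simp only [wp, Exp.Ok, Exp.eval, Store.setVar_var, hv₃, hu₃, reduceCtorEq, if_false,
            if_true, true_and, and_true, Store.setVar_arr]
          refine ⟨⟨by omega, by omega⟩, ⟨by omega, by omega⟩, fun hlt => ⟨by omega, by omega, ?_⟩,
            fun hle => ?_⟩
          · refine ⟨fun v a => ?_, h₃.sound.update fun v hv a ha => ?_, fun v u hvu a ha hd => ?_⟩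
            · simp only [Store.setArr_arr, Store.setVar_arr, true_and]
              have := h₃.le v a
              split_ifs with hva
              · obtain ⟨rfl, rfl⟩ := hva
                omega
              · exact this
            · by_cases hva : v = j ∧ a = b
              · obtain ⟨rfl, rfl⟩ := hva
                right
                simp only [Store.setArr_arr, Store.setVar_arr, and_self, if_true]
                intro hk
                exact (h₃.sound l hl _ ha (by omega)).edge he
              · left
                simp [hva]
            · simp only [Store.setArr_arr, Store.setVar_arr, true_and]
              have hl' := h₃.le l b
              split_ifs with hva
              · obtain ⟨rfl, rfl⟩ := hva
                by_cases hul : u = l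
                · subst hul
                  omega
                · have := h₃.relaxed v u hvu a ha (by omega)
                  omega
              · exact h₃.relaxed v u hvu a ha (by omega)
          · refine ⟨h₃.le, h₃.sound, fun v u hvu a ha hd => ?_⟩
            by_cases hul : v = j ∧ u = l ∧ a = b
            · obtain ⟨rfl, rfl, rfl⟩ := hul
              have := h₃.le u a
              omega
            · exact h₃.relaxed v u hvu a ha (by omega)
        · exact fun σ₃ _ h₃ => h₃.imp fun v u _ a ha hd => by omega
      · refine EdgesDone.imp h₂ fun v u hvu a ha hd => ?_
        by_contra hne
        obtain ⟨rfl, rfl⟩ : v = j ∧ u = l := by omega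
        exact hedge.2 hvu he
    · refine fun σ₂ _ h₂ => h₂.imp fun v u hvu a ha hd => ?_
      rw [hG] at hvu
      have := (orient_lt hvu).2
      dsimp only at this
      omega
  · refine fun σ₁ _ h₁ => h₁.imp fun v u hvu a ha hd => ?_
    rw [hG] at hvu
    exact (orient_lt hvu).1

/-- The relaxations by joining trees with the same root. -/
def relaxJoins : Cmd Var Arr :=
  repeatFor .v (var .n) (repeatFor .j (var .m)
    (set .y (arr .left (lit 0) (var .j)) ;; set .z (arr .right (lit 0) (var .j)) ;;
    set .x (add (arr .dist (var .v) (var .y)) (arr .dist (var .v) (var .z))) ;;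
    ite (sub (arr .dist (var .v) (add (var .y) (var .z))) (var .x))
      (putArr .dist (var .v) (add (var .y) (var .z)) (var .x)) skip))

/-- The state of the relaxations of the table `D₀` by joins: those that are described by `done` are
accomplished. -/
structure JoinsDone (G : Finset (ℕ × ℕ)) (P : Params) (D₀ : ℕ → ℕ → ℕ)
    (done : ℕ → ℕ → Prop) (D : ℕ → ℕ → ℕ) : Prop where
  le : ∀ v a, D v a ≤ D₀ v a
  sound : Sound G P.τ P.N P.t P.k D
  relaxed : ∀ v < P.N, ∀ p < 3 ^ P.t, done v p →
    D v (P.left p + P.right p) ≤ D₀ v (P.left p) + D₀ v (P.right p)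

theorem JoinsDone.imp {G : Finset (ℕ × ℕ)} {P : Params} {D₀ D : ℕ → ℕ → ℕ}
    {done done' : ℕ → ℕ → Prop} (h : JoinsDone G P D₀ done D)
    (hd : ∀ v < P.N, ∀ p < 3 ^ P.t, done' v p → done v p) : JoinsDone G P D₀ done' D :=
  ⟨h.le, h.sound, fun v hv p hp h' => h.relaxed v hv p hp (hd v hv p hp h')⟩

theorem wp_relaxJoins {B : ℕ} {P : Params} (hP : P.Valid B) {σ : Store Var Arr} (h : Holds P σ)
    (G : Finset (ℕ × ℕ)) (hs : Sound G P.τ P.N P.t P.k (σ.arr .dist)) :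
    wp B relaxJoins (fun σ' =>
      JoinsDone G P (σ.arr .dist) (fun _ _ => True) (σ'.arr .dist)) σ := by
  have hN := hP.N_le
  have hw := hP.two_le
  have hm := hP.three_le
  refine wp_repeatFor (fun j σ' => JoinsDone G P (σ.arr .dist) (fun v _ => v < j)
    (σ'.arr .dist)) P.N trivial (by simp [Exp.eval, h.n]) hN ⟨fun _ _ => le_rfl, hs, by simp⟩ ?_
    fun σ₁ _ h₁ => h₁.imp fun v hv _ _ _ => hv
  intro j hj σ₁ hσ₁ h₁
  have hh₁ := h.agree hσ₁ (by simp [Cmd.modVar]) (by simp [Cmd.modArr])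
  refine wp_repeatFor (fun l σ' => JoinsDone G P (σ.arr .dist)
    (fun v p => v < j ∨ v = j ∧ p < l) (σ'.arr .dist)) (3 ^ P.t) trivial
    (by simp [Exp.eval, hh₁.m]) hm (h₁.imp (by simp)) ?_
    fun σ₂ _ h₂ => h₂.imp fun v hv p hp _ => by omega
  intro l hl σ₂ hσ₂ h₂
  have hh₂ := (hh₁.setVar .v j (by simp)).agree hσ₂ (by simp [Cmd.modVar])
    (by simp [Cmd.modArr])
  have hv₂ : σ₂.var .v = j := by simpa using hσ₂.var .v (by simp [Cmd.modVar])
  have hcodes := hP.pairs.mem l hl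
  have hlt := hcodes.add_lt
  simp only [wp, Exp.Ok, Exp.eval, Store.setVar_var, hv₂, hh₂.left, hh₂.right, reduceCtorEq,
    if_false, if_true, true_and, and_true, Store.setVar_arr]
  have h3 := h₂.le j (P.left l)
  have h4 := h₂.le j (P.right l)
  refine ⟨by omega, by omega, ⟨⟨by omega, by omega⟩, by omega, by omega⟩, ⟨by omega, by omega⟩,
    fun hgt => ⟨by omega, by omega, ?_⟩, fun hle => ?_⟩
  · refine ⟨fun v a => ?_, h₂.sound.update fun v hv a ha => ?_, fun v hv p hp hd => ?_⟩
    · simp only [Store.setArr_arr, Store.setVar_arr, true_and]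
      have := h₂.le v a
      split_ifs with hva
      · obtain ⟨rfl, rfl⟩ := hva
        omega
      · exact this
    · by_cases hva : v = j ∧ a = P.left l + P.right l
      · obtain ⟨rfl, rfl⟩ := hva
        right
        simp only [Store.setArr_arr, Store.setVar_arr, and_self, if_true]
        intro hk
        exact (h₂.sound v hv _ (by omega) (by omega)).join (h₂.sound v hv _ (by omega) (by omega))
          hcodes
      · left
        simp [hva]
    · simp only [Store.setArr_arr, Store.setVar_arr, true_and]
      by_cases hpl : v = j ∧ p = l
      · obtain ⟨rfl, rfl⟩ := hpl
        simp only [and_self, if_true]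
        omega
      · have := h₂.relaxed v hv p hp (by omega)
        split_ifs with hva
        · obtain ⟨rfl, hva⟩ := hva
          rw [hva] at this
          omega
        · exact this
  · refine ⟨h₂.le, h₂.sound, fun v hv p hp hd => ?_⟩
    by_cases hpl : v = j ∧ p = l
    · obtain ⟨rfl, rfl⟩ := hpl
      omega
    · exact h₂.relaxed v hv p hp (by omega)

/-- Decides, with the result in the variable `b`, whether the root spans all terminals by at most
`k` edges of the graph or of its reversal. By truncation, `k + 1 - d` is nonzero if and only if
`d ≤ k`. -/
def decideSpans (out : Bool) (b : Var) : Cmd Var Arr :=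
  initTable ;; repeatFor .s (var .k) (relaxEdges out ;; relaxJoins) ;;
  set b (sub (add (var .k) (lit 1)) (arr .dist (var .r) (sub (var .w) (lit 1))))

theorem wp_decideSpans {B : ℕ} {P : Params} (hP : P.Valid B) {σ : Store Var Arr} (h : Holds P σ)
    (out : Bool) (b : Var) :
    wp B (decideSpans out b) (fun σ' => σ'.var b ≠ 0 ↔
      Spans (orient out (graphOf P.N (σ.arr .edge))) P.τ P.r (2 ^ P.t - 1) P.k) σ := by
  have hN := hP.N_le
  have hw := hP.two_le
  have hr := hP.r_lt
  have hpos : 0 < 2 ^ P.t := by positivity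
  generalize hG : orient out (graphOf P.N (σ.arr .edge)) = G
  refine wp_seq (wp_initTable hP h G) fun σ₁ hσ₁ h₁ => ?_
  have hh₁ := h.agree hσ₁ (by simp [Cmd.modVar, initTable]) (by simp [Cmd.modArr, initTable])
  have he₁ : σ₁.arr .edge = σ.arr .edge := hσ₁.arr .edge (by simp [Cmd.modArr, initTable])
  refine wp_repeatFor (fun ρ σ' => Sound G P.τ P.N P.t P.k (σ'.arr .dist) ∧
    Complete G P.τ P.N P.t ρ (σ'.arr .dist)) P.k trivial (by simp [Exp.eval, hh₁.k]) hP.k_le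
    h₁ ?_ ?_
  · rintro ρ hρ σ₂ hσ₂ ⟨hs₂, hc₂⟩
    have hh₂ := (hh₁.agree hσ₂ (by simp [Cmd.modVar, relaxEdges, relaxJoins])
      (by simp [Cmd.modArr, relaxEdges, relaxJoins])).setVar .s ρ (by simp)
    have he₂ : σ₂.arr .edge = σ.arr .edge :=
      (hσ₂.arr .edge (by simp [Cmd.modArr, relaxEdges, relaxJoins])).trans he₁
    refine wp_seq (wp_relaxEdges hP hh₂ out G (by simp [he₂, hG]) hs₂) fun σ₃ hσ₃ h₃ => ?_
    have hh₃ := hh₂.agree hσ₃ (by simp [Cmd.modVar, relaxEdges]) (by simp [Cmd.modArr, relaxEdges])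
    refine wp_conseq (wp_relaxJoins hP hh₃ G h₃.sound) fun σ₄ hσ₄ h₄ => ⟨h₄.sound, ?_⟩
    refine hc₂.succ (D₁ := σ₃.arr .dist) (fun e he => ?_) h₃.le
      (fun v u he a ha => h₃.relaxed v u he a ha trivial) h₄.le fun v hv a c hac => ?_
    · rw [← hG] at he
      exact (orient_lt he).2
    · obtain ⟨p, hp, rfl, rfl⟩ := hP.pairs.exists_eq a c hac
      exact h₄.relaxed v hv p hp trivial
  · rintro σ₂ hσ₂ ⟨hs₂, hc₂⟩
    have hh₂ := hh₁.agree hσ₂ (by simp [Cmd.modVar, relaxEdges, relaxJoins])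
      (by simp [Cmd.modArr, relaxEdges, relaxJoins])
    have := hc₂.le_iff hs₂ hr (a := 2 ^ P.t - 1) (by omega)
    simp only [wp, Exp.Ok, Exp.eval, Store.setVar_var, hh₂.k, hh₂.r, hh₂.w, if_true, true_and,
      and_true]
    refine ⟨⟨by omega, by omega⟩, ?_⟩
    rw [← this]
    omega

/-! ### Pruning the graph -/

/-- Deletes each edge in turn, and restores it if the rest is not good. -/
def prune : Cmd Var Arr :=
  repeatFor .v₀ (var .n) (repeatFor .u₀ (var .n) (ite (arr .edge (var .v₀) (var .u₀))
    (putArr .edge (var .v₀) (var .u₀) (lit 0) ;;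
      decideSpans true .b₁ ;; decideSpans false .b₂ ;;
      ite (var .b₁) (ite (var .b₂) skip (putArr .edge (var .v₀) (var .u₀) (lit 1)))
        (putArr .edge (var .v₀) (var .u₀) (lit 1))) skip))

/-- The state of the adjacency matrix during the pruning of `e₀`: those pairs of vertices that are
described by `done` have been treated. -/
structure Pruned (P : Params) (e₀ : ℕ → ℕ → ℕ) (done : ℕ → ℕ → Prop) (e : ℕ → ℕ → ℕ) : Prop where
  le_one : ∀ v < P.N, ∀ u < P.N, e v u ≤ 1
  subset : graphOf P.N e ⊆ graphOf P.N e₀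
  good : Good P.τ P.t P.r P.k (graphOf P.N e₀) → Good P.τ P.t P.r P.k (graphOf P.N e)
  minimal : ∀ v u, (v, u) ∈ graphOf P.N e → done v u →
    ¬ Good P.τ P.t P.r P.k ((graphOf P.N e).erase (v, u))

theorem Pruned.imp {P : Params} {e₀ e : ℕ → ℕ → ℕ} {done done' : ℕ → ℕ → Prop}
    (h : Pruned P e₀ done e)
    (hd : ∀ v u, (v, u) ∈ graphOf P.N e → done' v u → done v u) : Pruned P e₀ done' e :=
  ⟨h.le_one, h.subset, h.good, fun v u he h' => h.minimal v u he (hd v u he h')⟩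

/-- A valid root is needed only if there are vertices. -/
theorem wp_prune {B : ℕ} {P : Params} (hN : P.N ≤ B) (hP : 0 < P.N → P.Valid B)
    {σ : Store Var Arr} (h : Holds P σ)
    (h1 : ∀ v < P.N, ∀ u < P.N, σ.arr .edge v u ≤ 1) :
    wp B prune (fun σ' => Pruned P (σ.arr .edge) (fun _ _ => True) (σ'.arr .edge)) σ := by
  refine wp_repeatFor (fun j σ' => Pruned P (σ.arr .edge) (fun v _ => v < j) (σ'.arr .edge)) P.N
    trivial (by simp [Exp.eval, h.n]) hN ⟨h1, fun _ h => h, fun h => h, by simp⟩ ?_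
    fun σ₁ _ h₁ => h₁.imp fun v u hvu _ => (mem_graphOf.1 hvu).1.1
  intro j hj σ₁ hσ₁ h₁
  have hV := hP (by omega)
  have hh₁ := h.agree hσ₁ (by simp [Cmd.modVar, decideSpans, initTable, relaxEdges, relaxJoins])
    (by simp [Cmd.modArr, decideSpans, initTable, relaxEdges, relaxJoins])
  refine wp_repeatFor (fun l σ' => Pruned P (σ.arr .edge) (fun v u => v < j ∨ v = j ∧ u < l)
    (σ'.arr .edge)) P.N trivial (by simp [Exp.eval, hh₁.n]) hN (h₁.imp (by simp)) ?_
    fun σ₂ _ h₂ => h₂.imp fun v u hvu _ => by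
      have := (mem_graphOf.1 hvu).1.2
      omega
  intro l hl σ₂ hσ₂ h₂
  have hh₂ := (hh₁.setVar .v₀ j (by simp)).agree hσ₂
    (by simp [Cmd.modVar, decideSpans, initTable, relaxEdges, relaxJoins])
    (by simp [Cmd.modArr, decideSpans, initTable, relaxEdges, relaxJoins])
  have hv₂ : σ₂.var .v₀ = j := by
    simpa using hσ₂.var .v₀ (by simp [Cmd.modVar, decideSpans, initTable, relaxEdges, relaxJoins])
  have hok : (arr Arr.edge (var Var.v₀) (var Var.u₀)).Ok B (σ₂.setVar .u₀ l) := by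
    simp only [Exp.Ok, Exp.eval, Store.setVar_var, hv₂, reduceCtorEq, if_false, if_true, true_and]
    omega
  have heval : (arr Arr.edge (var Var.v₀) (var Var.u₀)).eval (σ₂.setVar .u₀ l) =
      σ₂.arr .edge j l := by
    simp [Exp.eval, hv₂]
  refine ⟨hok, fun he => ?_, fun he => ?_⟩
  · rw [heval] at he
    refine ⟨⟨trivial, trivial, trivial⟩, ?_, ?_, ?_⟩
    · simp only [Exp.eval, Store.setVar_var, hv₂, reduceCtorEq, if_false]
      omega
    · simp only [Exp.eval, Store.setVar_var, if_true]
      omega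
    have hh₃ := (hh₂.setVar .u₀ l (by simp)).congr
      (σ' := (σ₂.setVar .u₀ l).setArr .edge j l 0) (fun _ _ => rfl)
      (by simp [funext_iff])
    have heq : (σ₂.setVar .u₀ l).setArr .edge (eval (σ₂.setVar .u₀ l) (var .v₀))
        (eval (σ₂.setVar .u₀ l) (var .u₀)) (eval (σ₂.setVar .u₀ l) (lit 0)) =
        (σ₂.setVar .u₀ l).setArr .edge j l 0 := by
      simp [Exp.eval, hv₂]
    rw [heq]
    have hgraph : graphOf P.N (((σ₂.setVar .u₀ l).setArr .edge j l 0).arr .edge) =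
        (graphOf P.N (σ₂.arr .edge)).erase (j, l) := by
      ext ⟨v, u⟩
      simp only [mem_graphOf, Finset.mem_erase, Store.setArr_arr, Store.setVar_arr, true_and, ne_eq,
        Prod.mk.injEq]
      by_cases hvu : v = j ∧ u = l
      · simp [hvu]
      · simp only [hvu, if_false, not_false_eq_true, true_and]
    generalize hσ₃ : (σ₂.setVar .u₀ l).setArr .edge j l 0 = σ₃ at *
    refine wp_seq (wp_decideSpans hV hh₃ true .b₁) fun σ₄ hσ₄ h₄ => ?_
    have hh₄ := hh₃.agree hσ₄
      (by simp [Cmd.modVar, decideSpans, initTable, relaxEdges, relaxJoins])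
      (by simp [Cmd.modArr, decideSpans, initTable, relaxEdges, relaxJoins])
    have he₄ : σ₄.arr .edge = σ₃.arr .edge :=
      hσ₄.arr .edge (by simp [Cmd.modArr, decideSpans, initTable, relaxEdges, relaxJoins])
    refine wp_seq (wp_decideSpans hV hh₄ false .b₂) fun σ₅ hσ₅ h₅ => ?_
    have hb₁ : σ₅.var .b₁ = σ₄.var .b₁ :=
      hσ₅.var .b₁ (by simp [Cmd.modVar, decideSpans, initTable, relaxEdges, relaxJoins])
    have he₅ : σ₅.arr .edge = σ₃.arr .edge :=
      (hσ₅.arr .edge (by simp [Cmd.modArr, decideSpans, initTable, relaxEdges, relaxJoins])).trans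
        he₄
    have hv₅ : σ₅.var .v₀ = j := by
      rw [hσ₅.var .v₀ (by simp [Cmd.modVar, decideSpans, initTable, relaxEdges, relaxJoins]),
        hσ₄.var .v₀ (by simp [Cmd.modVar, decideSpans, initTable, relaxEdges, relaxJoins]), ← hσ₃]
      simp [hv₂]
    have hu₅ : σ₅.var .u₀ = l := by
      rw [hσ₅.var .u₀ (by simp [Cmd.modVar, decideSpans, initTable, relaxEdges, relaxJoins]),
        hσ₄.var .u₀ (by simp [Cmd.modVar, decideSpans, initTable, relaxEdges, relaxJoins]), ← hσ₃]
      simp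
    have hgood : (σ₄.var .b₁ ≠ 0 ∧ σ₅.var .b₂ ≠ 0) ↔
        Good P.τ P.t P.r P.k ((graphOf P.N (σ₂.arr .edge)).erase (j, l)) := by
      rw [h₄, h₅, he₄, hgraph]
      rfl
    -- as the entries are at most `1`, restoring the edge gives the former adjacency matrix
    have hrestore : ¬ Good P.τ P.t P.r P.k ((graphOf P.N (σ₂.arr .edge)).erase (j, l)) →
        wp B (putArr Arr.edge (var Var.v₀) (var Var.u₀) (lit 1)) (fun σ' => Pruned P (σ.arr .edge)
          (fun v u => v < j ∨ v = j ∧ u < l + 1) (σ'.arr .edge)) σ₅ := by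
      intro hng
      simp only [wp, Exp.Ok, Exp.eval, hv₅, hu₅, true_and]
      refine ⟨by omega, by omega, ?_⟩
      have hback : (σ₅.setArr .edge j l 1).arr .edge = σ₂.arr .edge := by
        funext v u
        simp only [Store.setArr_arr, true_and, he₅, ← hσ₃, Store.setVar_arr]
        split_ifs with hvu
        · obtain ⟨rfl, rfl⟩ := hvu
          have := h₂.le_one v hj u hl
          omega
        · rfl
      rw [hback]
      refine ⟨h₂.le_one, h₂.subset, h₂.good, fun v u hvu hd => ?_⟩
      by_cases hvu' : v = j ∧ u = l
      · obtain ⟨rfl, rfl⟩ := hvu'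
        exact hng
      · exact h₂.minimal v u hvu (by omega)
    simp only [wp, Exp.Ok, Exp.eval, true_and, hb₁] at hrestore ⊢
    refine ⟨fun hb => ⟨fun hb' => ?_, fun hb' => hrestore fun hg => (hgood.2 hg).2 hb'⟩,
      fun hb => hrestore fun hg => (hgood.2 hg).1 hb⟩
    have hg := hgood.1 ⟨hb, hb'⟩
    rw [he₅]
    refine ⟨fun v hv u hu => ?_, ?_, fun _ => by rwa [hgraph], fun v u hvu hd hg' => ?_⟩
    · rw [← hσ₃]
      simp only [Store.setArr_arr, Store.setVar_arr, true_and]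
      split_ifs
      · omega
      · exact h₂.le_one v hv u hu
    · rw [hgraph]
      exact (Finset.erase_subset _ _).trans h₂.subset
    · -- by monotonicity, the edges that could not be deleted before cannot be deleted now
      rw [hgraph] at hvu hg'
      rw [Finset.mem_erase, ne_eq, Prod.mk.injEq] at hvu
      exact h₂.minimal v u hvu.2 (by omega)
        (hg'.mono (Finset.erase_subset_erase _ (Finset.erase_subset _ _)))
  · rw [heval] at he
    refine Pruned.imp h₂ fun v u hvu hd => ?_
    by_contra hne
    obtain ⟨rfl, rfl⟩ : v = j ∧ u = l := by omega
    exact (mem_graphOf.1 hvu).2 he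

/-- Writes the adjacency matrix. -/
def writeEdges : Cmd Var Arr :=
  set .p (lit 0) ;;
  repeatFor .v (var .n) (repeatFor .u (var .n)
    (putRaw (var .p) (arr .edge (var .v) (var .u)) ;; set .p (add (var .p) (lit 1)))) ;;
  set .k (var .p)

theorem wp_writeEdges {B N : ℕ} {σ : Store Var Arr} (hn : σ.var .n = N) (hB : N ≤ B)
    (hN : N * N ≤ σ.len) :
    wp B writeEdges (fun τ => τ.var .k = N * N ∧
      ∀ v < N, ∀ u < N, τ.raw (v * N + u) = σ.arr .edge v u) σ := by
  refine ⟨trivial, ?_⟩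
  refine wp_repeatFor (fun j τ => τ.var .p = j * N ∧
      ∀ v < j, ∀ u < N, τ.raw (v * N + u) = σ.arr .edge v u) N trivial
    (by simp [Exp.eval, hn]) hB (by simp [Exp.eval]) ?_ ?_
  · rintro j hj τ hτ ⟨hp, he⟩
    have hn' : τ.var .n = N := by simpa [hn] using hτ.var .n (by simp [Cmd.modVar])
    have hr : τ.arr = σ.arr := funext fun a => hτ.arr a (by simp [Cmd.modArr])
    refine wp_repeatFor (fun l τ => τ.var .p = j * N + l ∧
        ∀ i < j * N + l, ∀ v < N, ∀ u < N, i = v * N + u → τ.raw i = σ.arr .edge v u)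
      N trivial (by simp [Exp.eval, hn']) hB ?_ ?_ ?_
    · refine ⟨by simpa using hp, ?_⟩
      rintro i hi v hv u hu rfl
      refine he v ?_ u hu
      by_contra hle
      have := Nat.mul_le_mul_right N (Nat.le_of_not_lt hle)
      omega
    · rintro l hl τ' hτ' ⟨hp', he'⟩
      have hv : τ'.var .v = j := by simpa using hτ'.var .v (by simp [Cmd.modVar])
      have hr' : τ'.arr = σ.arr :=
        (funext fun a => hτ'.arr a (by simp [Cmd.modArr])).trans hr
      have hl' : τ'.len = σ.len := hτ'.len.trans hτ.len
      have := index_lt hj hl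
      simp only [wp, Exp.Ok, Exp.eval, Store.setVar_var, Store.setVar_raw, Store.setVar_len, hv,
        hr', hl', hp', reduceCtorEq, if_false, if_true, true_and, Store.setRaw_var,
        Store.setRaw_raw, Store.setVar_arr, and_true]
      refine ⟨⟨by omega, by omega⟩, by omega, by omega, ?_⟩
      rintro i hi v hv u hu rfl
      split_ifs with h
      · have huN : 0 < N := by omega
        have h1 := congrArg (· / N) h
        have h2 := congrArg (· % N) h
        simp only [Nat.mul_add_mod_of_lt hu, Nat.mul_add_mod_of_lt hl] at h2
        simp only [mul_comm _ N, Nat.mul_add_div huN, Nat.div_eq_of_lt hu, Nat.div_eq_of_lt hl]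
          at h1
        simp only [add_zero] at h1
        rw [h1, h2]
      · exact he' _ (by omega) v hv u hu rfl
    · rintro τ' - ⟨hp', he'⟩
      refine ⟨by rw [hp']; ring, fun v hv u hu => he' _ ?_ v (by omega) u hu rfl⟩
      have := Nat.mul_le_mul_right N (Nat.succ_le_of_lt hv)
      rw [Nat.succ_eq_add_one, add_mul, one_mul, add_mul, one_mul] at this
      omega
  · rintro τ hτ ⟨hp, he⟩
    exact ⟨trivial, by simpa [Exp.eval] using hp, he⟩

/-! ### The algorithm -/

/-- The algorithm. By truncation, `k + 2 - t` is nonzero if and only if `t ≤ k + 1`. -/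
def solve : Cmd Var Arr :=
  readSize ;; readEdges ;; readTerminals ;;
  ite (sub (add (var .k) (lit 2)) (var .t)) (makePairs ;; prune ;; writeEdges) skip

/-- The store contains an adjacency matrix and a set of vertices, in the encoding of an instance. -/
structure IsInput (N : ℕ) (E : Finset (ℕ × ℕ)) (T : Finset ℕ) (σ : Store Var Arr) : Prop where
  ones : ∀ i < N, σ.raw i ≠ 0
  zero : σ.raw N = 0
  edge : ∀ v < N, ∀ u < N, σ.raw (N + 1 + (v * N + u)) = if (v, u) ∈ E then 1 else 0
  term : ∀ v < N, σ.raw (N + 1 + N * N + v) ≠ 0 ↔ v ∈ T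
  len : σ.len = N + 1 + N * N + N
  edge_lt : ∀ p ∈ E, p.1 < N ∧ p.2 < N
  term_lt : ∀ v ∈ T, v < N

theorem Lists.card_eq {f : ℕ → ℕ} {t : ℕ} {T : Finset ℕ} (h : Lists f t (· ∈ T)) : T.card = t := by
  have : T = (Finset.range t).image f := by
    ext v
    simp only [Finset.mem_image, Finset.mem_range]
    exact ⟨h.exists_eq v, by rintro ⟨i, hi, rfl⟩; exact h.mem i hi⟩
  rw [this, Finset.card_image_of_injOn, Finset.card_range]
  simpa [Set.InjOn] using h.inj

/-- If there is a solution of cost at most `k`, then one of cost at most `2 * k` is computed, and the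
length of its code is left in the variable `k`. Loop bounds and array indices are at most `B`. -/
theorem wp_solve {B N k : ℕ} {E : Finset (ℕ × ℕ)} {T : Finset ℕ} {σ : Store Var Arr}
    (hI : IsInput N E T σ) (hk : σ.var .k = k) (h0 : ∀ q, q ≠ Var.k → σ.var q = 0)
    (hB : σ.len ≤ B) (hkB : 3 ^ (k + 1) ≤ B) :
    wp B solve (fun σ' => (∃ F ⊆ E, F.card ≤ k ∧ ∀ a ∈ T, ∀ b ∈ T, Reach F a b) →
      ∃ F ⊆ E, F.card ≤ 2 * k ∧ (∀ a ∈ T, ∀ b ∈ T, Reach F a b) ∧ σ'.var .k = N * N ∧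
        ∀ v < N, ∀ u < N, σ'.raw (v * N + u) = if (v, u) ∈ F then 1 else 0) σ := by
  have hlen := hI.len
  have hNB : N ≤ B := by omega
  refine wp_seq (wp_readSize (h0 .n (by simp)) hB (by omega) hI.ones hI.zero) fun σ₁ hσ₁ hn₁ => ?_
  have hr₁ : σ₁.raw = σ.raw := hσ₁.raw (by simp [readSize, Cmd.modRaw])
  have hl₁ := hσ₁.len
  refine wp_seq (wp_readEdges hn₁ hNB (by omega)) fun σ₂ hσ₂ ⟨hp₂, he₂⟩ => ?_
  have hr₂ : σ₂.raw = σ.raw := (hσ₂.raw (by simp [readEdges, Cmd.modRaw])).trans hr₁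
  have hl₂ := hσ₂.len
  have hv₂ : ∀ q ∈ [Var.k, .t, .r], σ₂.var q = σ.var q := by
    intro q hq
    rw [hσ₂.var q (by rintro h; revert hq; revert h; cases q <;> simp [readEdges, Cmd.modVar]),
      hσ₁.var q (by rintro h; revert hq; revert h; cases q <;> simp [readSize, Cmd.modVar])]
  have hn₂ : σ₂.var .n = N := by rw [hσ₂.var .n (by simp [readEdges, Cmd.modVar]), hn₁]
  refine wp_seq (wp_readTerminals hn₂ hNB (by rw [hv₂ _ (by simp), h0 _ (by simp)])
    (by rw [hv₂ _ (by simp), h0 _ (by simp)]) hp₂ (by omega)) fun σ₃ hσ₃ ⟨hL, hr0, hrt⟩ => ?_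
  have hn₃ : σ₃.var .n = N := by rw [hσ₃.var .n (by simp [readTerminals, Cmd.modVar]), hn₂]
  have hk₃ : σ₃.var .k = k := by
    rw [hσ₃.var .k (by simp [readTerminals, Cmd.modVar]), hv₂ _ (by simp), hk]
  have he₃ : σ₃.arr .edge = σ₂.arr .edge := hσ₃.arr .edge (by simp [readTerminals, Cmd.modArr])
  have hl₃ := hσ₃.len
  have hLT : Lists (σ₃.arr .term 0) (σ₃.var .t) (· ∈ T) := by
    have hiff : ∀ v, (v < N ∧ σ₂.raw (N + 1 + N * N + v) ≠ 0) ↔ v ∈ T := by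
      intro v
      rw [hr₂]
      exact ⟨fun h => (hI.term v h.1).1 h.2, fun h => ⟨hI.term_lt v h, (hI.term v
        (hI.term_lt v h)).2 h⟩⟩
    simpa only [hiff] using hL
  have hgE : graphOf N (σ₃.arr .edge) = E := by
    ext ⟨v, u⟩
    rw [mem_graphOf, he₃]
    constructor
    · rintro ⟨⟨hv, hu⟩, h⟩
      rw [he₂ v hv u hu, hr₁, hI.edge v hv u hu] at h
      by_contra hne
      simp [hne] at h
    · intro h
      obtain ⟨hv, hu⟩ := hI.edge_lt _ h
      refine ⟨⟨hv, hu⟩, ?_⟩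
      rw [he₂ v hv u hu, hr₁, hI.edge v hv u hu, if_pos h]
      simp
  refine ⟨by simp [Exp.Ok], fun hle => ?_, fun hgt => ?_⟩
  · simp only [Exp.eval, hk₃] at hle
    generalize ht : σ₃.var .t = t at *
    have ht1 : t ≤ k + 1 := by omega
    have h3 : 3 ^ t ≤ B := (Nat.pow_le_pow_right (by omega) ht1).trans hkB
    have hkB' : k + 1 ≤ B := (Nat.lt_pow_self (by omega)).le.trans hkB
    refine wp_seq (wp_makePairs ht (by omega) h3) fun σ₄ hσ₄ ⟨hw₄, hm₄, hL₄⟩ => ?_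
    set P : Params := ⟨N, t, σ₃.var .r, k, σ₃.arr .term 0, σ₄.arr .left 0, σ₄.arr .right 0⟩ with hP
    have hn₄ : σ₄.var .n = N := by rw [hσ₄.var .n (by simp [makePairs, Cmd.modVar]), hn₃]
    have hh₄ : Holds P σ₄ := by
      refine ⟨hn₄, ?_, ?_, ?_, hw₄, hm₄, ?_, rfl, rfl⟩
      · rw [hσ₄.var .t (by simp [makePairs, Cmd.modVar]), ht]
      · rw [hσ₄.var .r (by simp [makePairs, Cmd.modVar])]
      · rw [hσ₄.var .k (by simp [makePairs, Cmd.modVar]), hk₃]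
      · rw [hσ₄.arr .term (by simp [makePairs, Cmd.modArr])]
    have he₄ : σ₄.arr .edge = σ₃.arr .edge := hσ₄.arr .edge (by simp [makePairs, Cmd.modArr])
    have hV : 0 < P.N → P.Valid B := by
      intro hpos
      refine ⟨hNB, by simp only [hP]; omega, by simp only [hP]; omega,
        (Nat.pow_le_pow_left (by omega) t).trans h3, h3, ?_, fun i hi => hI.term_lt _ (hLT.mem i hi),
        hLT.inj, hL₄⟩
      rcases Nat.eq_zero_or_pos t with h | h
      · simpa [hP, hr0 h] using hpos
      · obtain ⟨i, hi, hir⟩ := hrt h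
        simpa only [hP, ← hir] using hI.term_lt _ (hLT.mem i hi)
    refine wp_seq (wp_prune hNB hV hh₄ ?_) fun σ₅ hσ₅ h₅ => ?_
    · intro v hv u hu
      rw [he₄, he₃, he₂ v hv u hu, hr₁, hI.edge v hv u hu]
      split_ifs <;> omega
    have hn₅ : σ₅.var .n = N := by
      rw [hσ₅.var .n (by simp [Cmd.modVar, prune, decideSpans, initTable, relaxEdges, relaxJoins]),
        hn₄]
    have hl₄ := hσ₄.len
    have hl₅ := hσ₅.len
    refine wp_conseq (wp_writeEdges hn₅ hNB (by omega)) fun σ₆ _ ⟨hk₆, hr₆⟩ => ?_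
    rintro ⟨F, hFE, hFk, hF⟩
    have hE : graphOf P.N (σ₄.arr .edge) = E := by rw [he₄]; exact hgE
    have hgood : Good P.τ P.t P.r P.k E := by
      refine good_of_reach hFE hFk fun i hi => ?_
      obtain ⟨l, hl, hlr⟩ := hrt (by simp only [hP] at hi; omega)
      simp only [hP, ← hlr]
      exact ⟨hF _ (hLT.mem l hl) _ (hLT.mem i hi), hF _ (hLT.mem i hi) _ (hLT.mem l hl)⟩
    have hg₅ := h₅.good (by rwa [hE])
    refine ⟨graphOf N (σ₅.arr .edge), by rw [← hE]; exact h₅.subset,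
      hg₅.card_le fun ⟨v, u⟩ he => h₅.minimal v u he trivial, fun a ha b hb => ?_, hk₆,
      fun v hv u hu => ?_⟩
    · obtain ⟨i, hi, rfl⟩ := hLT.exists_eq a ha
      obtain ⟨l, hl, rfl⟩ := hLT.exists_eq b hb
      exact hg₅.reach hi hl
    · rw [hr₆ v hv u hu]
      have := h₅.le_one v hv u hu
      simp only [mem_graphOf, hv, hu, and_self, true_and]
      split_ifs <;> omega
  · rintro ⟨F, hFE, hFk, hF⟩
    -- there are more than `k + 1` terminals, so `k` edges do not suffice
    simp only [Exp.eval, hk₃] at hgt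
    have hc := hLT.card_eq
    obtain ⟨i, hi, hir⟩ := hrt (by omega)
    have := card_le_of_reach fun b hb => hF _ (hLT.mem i hi) b hb
    omega

/-! ### Instances and their encodings -/

/-- The edges between the vertices `0, …, n - 1`, as pairs of natural numbers. -/
def toNat {n : ℕ} (F : Finset (Fin n × Fin n)) : Finset (ℕ × ℕ) :=
  F.image fun p => (p.1.val, p.2.val)

theorem mem_toNat {n : ℕ} {F : Finset (Fin n × Fin n)} {v u : Fin n} :
    (v.val, u.val) ∈ toNat F ↔ (v, u) ∈ F := by
  simp only [toNat, Finset.mem_image, Prod.mk.injEq]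
  constructor
  · rintro ⟨⟨a, b⟩, h, h1, h2⟩
    rwa [← Fin.ext h1, ← Fin.ext h2]
  · exact fun h => ⟨(v, u), h, rfl, rfl⟩

theorem toNat_lt {n : ℕ} {F : Finset (Fin n × Fin n)} {p : ℕ × ℕ} (hp : p ∈ toNat F) :
    p.1 < n ∧ p.2 < n := by
  obtain ⟨⟨a, b⟩, _, rfl⟩ := Finset.mem_image.1 hp
  exact ⟨a.2, b.2⟩

theorem reach_toNat {n : ℕ} {F : Finset (Fin n × Fin n)} {v u : Fin n} :
    Reach (toNat F) v u ↔ Relation.ReflTransGen (fun v u => (v, u) ∈ F) v u := by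
  constructor
  · intro h
    have : ∀ w : ℕ, Reach (toNat F) v w →
        ∃ w' : Fin n, w'.val = w ∧ Relation.ReflTransGen (fun v u => (v, u) ∈ F) v w' := by
      intro w hw
      induction hw with
      | refl => exact ⟨v, rfl, .refl⟩
      | @tail b c _ hbc ih =>
        obtain ⟨b', rfl, ih⟩ := ih
        have hc := (toNat_lt hbc).2
        exact ⟨⟨c, hc⟩, rfl, ih.tail (mem_toNat.1 (show (b'.val, (⟨c, hc⟩ : Fin n).val) ∈ _ from hbc))⟩
    obtain ⟨u', hu, h⟩ := this u h
    rwa [← Fin.ext hu]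
  · intro h
    induction h with
    | refl => exact .refl
    | tail _ h ih => exact ih.tail (mem_toNat.2 h)

theorem exists_toNat_eq {n : ℕ} {E : Finset (Fin n × Fin n)} {G : Finset (ℕ × ℕ)}
    (h : G ⊆ toNat E) : ∃ F ⊆ E, toNat F = G := by
  obtain ⟨F, hF, rfl⟩ := Finset.subset_image_iff.1 h
  exact ⟨F, hF, rfl⟩

theorem card_toNat {n : ℕ} (F : Finset (Fin n × Fin n)) : (toNat F).card = F.card :=
  Finset.card_image_of_injective _ fun p q h => by
    simp only [Prod.mk.injEq] at h
    exact Prod.ext (Fin.ext h.1) (Fin.ext h.2)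

/-- The store of the program on input `(w, k)`. -/
def initialStore (w : List Bool) (k : ℕ) : Store Var Arr where
  var q := if q = .k then k else 0
  raw i := (w[i]?.getD false).toNat
  arr _ _ _ := 0
  len := w.length

theorem rep_initial (w : List Bool) (k : ℕ) : Rep (initialStore w k) (RAM.initial w k) where
  var q := by cases q <;> simp [RAM.initial, initialStore, varReg, Numbered.num, Var.ctorIdx]
  len := by simp [RAM.initial, initialStore, tmp]
  raw i _ := rfl
  arr a i j := by
    have : w.length ≤ addr w.length a i j := Nat.le_add_left _ _
    simp [RAM.initial, initialStore, List.getElem?_eq_none this]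

theorem finProdFinEquiv_symm_apply {n v u : ℕ} (hv : v < n) (hu : u < n) (h : v * n + u < n * n) :
    finProdFinEquiv.symm ⟨v * n + u, h⟩ = (⟨v, hv⟩, ⟨u, hu⟩) := by
  rw [Equiv.symm_apply_eq]
  apply Fin.ext
  simp only [finProdFinEquiv_apply_val]
  ring

theorem length_encode (x : SCSSInstance) :
    x.encode.length = x.n + 1 + x.n * x.n + x.n := by
  simp [SCSSInstance.encode, SCSSInstance.edgeBits, SCSSInstance.vertexBits]
  ring

theorem isInput_initialStore (x : SCSSInstance) (k : ℕ) :
    IsInput x.n (toNat x.edges) (x.terminals.image Fin.val) (initialStore x.encode k) where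
  ones i hi := by
    simp [initialStore, SCSSInstance.encode, List.getElem?_append, hi]
  zero := by simp [initialStore, SCSSInstance.encode]
  edge v hv u hu := by
    have hlt := index_lt hv hu
    have hm : (v, u) ∈ toNat x.edges ↔ ((⟨v, hv⟩, ⟨u, hu⟩) : Fin x.n × Fin x.n) ∈ x.edges :=
      mem_toNat (v := ⟨v, hv⟩) (u := ⟨u, hu⟩)
    have h1 : x.n + 1 + (v * x.n + u) - x.n = (v * x.n + u) + 1 := by omega
    have h2 : ¬ x.n + 1 + (v * x.n + u) < x.n := by omega
    simp only [initialStore, SCSSInstance.encode, List.getElem?_append, List.length_replicate, h2,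
      if_false, h1, List.getElem?_cons_succ]
    simp only [SCSSInstance.edgeBits, List.length_ofFn, hlt, if_true, List.getElem?_ofFn, dite_true,
      Option.getD_some, finProdFinEquiv_symm_apply hv hu, hm]
    split_ifs with h <;> simp [h]
  term v hv := by
    have h1 : x.n + 1 + x.n * x.n + v - x.n = (x.n * x.n + v) + 1 := by omega
    have h2 : ¬ x.n + 1 + x.n * x.n + v < x.n := by omega
    simp only [initialStore, SCSSInstance.encode, List.getElem?_append, List.length_replicate, h2,
      if_false, h1, List.getElem?_cons_succ]
    have h3 : ¬ x.n * x.n + v < x.n * x.n := by omega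
    simp only [SCSSInstance.edgeBits, List.length_ofFn, h3, if_false, Nat.add_sub_cancel_left,
      SCSSInstance.vertexBits, List.getElem?_ofFn, hv, dite_true, Option.getD_some]
    simpa using ⟨fun h => ⟨⟨v, hv⟩, h, rfl⟩, by rintro ⟨a, ha, rfl⟩; exact ha⟩
  len := length_encode x
  edge_lt _ hp := toNat_lt hp
  term_lt v hv := by
    obtain ⟨a, _, rfl⟩ := Finset.mem_image.1 hv
    exact a.2

theorem connects_iff {x : SCSSInstance} {F : Finset (Fin x.n × Fin x.n)} :
    x.Connects F ↔ ∀ a ∈ x.terminals.image Fin.val, ∀ b ∈ x.terminals.image Fin.val,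
      Reach (toNat F) a b := by
  simp only [Finset.forall_mem_image, reach_toNat]
  refine ⟨fun h a ha b hb => ?_, fun h a ha b hb _ => h ha hb⟩
  by_cases hab : a = b
  · rw [hab]
  · exact h a ha b hb hab

theorem hasOutput_of_rep {n : ℕ} {F : Finset (Fin n × Fin n)} {σ : Store Var Arr} {s : RAM.State}
    (hs : Rep σ s) (hk : σ.var .k = n * n) (hn : n * n ≤ σ.len)
    (h : ∀ v < n, ∀ u < n, σ.raw (v * n + u) = if (v, u) ∈ toNat F then 1 else 0) :
    s.HasOutput (SCSSInstance.edgeBits F) := by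
  have hl : (SCSSInstance.edgeBits F).length = n * n := by simp [SCSSInstance.edgeBits]
  refine ⟨?_, fun i hi => ?_⟩
  · rw [hl, ← hk, ← hs.var]
    rfl
  · rw [hl] at hi
    obtain ⟨⟨v, u⟩, hvu⟩ : ∃ p, p = finProdFinEquiv.symm ⟨i, hi⟩ := ⟨_, rfl⟩
    have hi' : i = v.val * n + u.val := by
      have := congrArg Fin.val ((Equiv.eq_symm_apply _).1 hvu)
      rw [finProdFinEquiv_apply_val] at this
      dsimp only at this
      rw [← this, mul_comm, add_comm]
    rw [hs.raw i (hi.trans_le hn)]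
    simp only [SCSSInstance.edgeBits, List.getElem_ofFn, ← hvu]
    rw [hi', h v v.2 u u.2]
    simp only [mem_toNat]
    split_ifs with h <;> simp [h]

theorem computable_bound (C D : ℕ) : Computable fun k : ℕ => C * (3 ^ (k + 1) + 2) ^ D := by
  have hpow : Primrec₂ ((· ^ ·) : ℕ → ℕ → ℕ) := Primrec₂.unpaired'.1 Nat.Primrec.pow
  exact (Primrec.nat_mul.comp (Primrec.const C) (hpow.comp (Primrec.nat_add.comp
    (hpow.comp (Primrec.const 3) Primrec.succ) (Primrec.const 2)) (Primrec.const D))).to_comp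

theorem isMinRatio_two : IsMinRatio fun _ => (2 : ℝ) where
  one_le _ := by norm_num
  computable := by
    refine ⟨fun _ j => 2 * (j + 1), ?_, fun k j => ?_⟩
    · exact (Primrec.nat_mul.comp (Primrec.const 2) (Primrec.succ.comp Primrec.snd)).to_comp
    · have : (j : ℝ) + 1 ≠ 0 := by positivity
      push_cast
      rw [mul_div_cancel_right₀ _ this, sub_self, abs_zero]
      positivity
  mono _ _ h := mul_le_mul_of_nonneg_right (Nat.cast_le.2 h) zero_le_two

end SteinerProgram

open BoundedLoop Steiner SteinerProgram

theorem mainTheorem3 :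
    ∃ A : RAM.Program, IsFPTApproxAlgorithm SCSS (fun _ => (2 : ℝ)) A := by
  obtain ⟨C, D, hC⟩ := halts_compile solve
  refine ⟨compile solve 1, isMinRatio_two, fun k => C * (3 ^ (k + 1) + 2) ^ D, D,
    computable_bound C D, fun (x : SCSSInstance) k => ?_⟩
  change ∃ t s, RAM.Exec _ (RAM.initial x.encode k) t s ∧ t ≤ _ * x.encode.length ^ D ∧ _
  set L := x.encode.length with hL
  have hlen : L = x.n + 1 + x.n * x.n + x.n := length_encode x
  obtain ⟨t, s, hex, ht, ⟨σ, hσ, hpost⟩, hr⟩ := hC 1 (L + 3 ^ (k + 1)) _ _ _ le_rfl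
    (rep_initial x.encode k) (wp_solve (isInput_initialStore x k) (by simp [initialStore])
      (fun q hq => by simp [initialStore, hq]) (Nat.le_add_right _ _) (Nat.le_add_left _ _))
  refine ⟨t, s, hex, ht.trans ?_, fun hne hopt => ?_⟩
  · -- the input is not empty, so `L + 3 ^ (k + 1) + 1 ≤ (3 ^ (k + 1) + 2) * L`
    dsimp only
    rw [mul_assoc, ← mul_pow]
    refine Nat.mul_le_mul_left _ (Nat.pow_le_pow_left ?_ _)
    have : 3 ^ (k + 1) * 1 ≤ 3 ^ (k + 1) * L := Nat.mul_le_mul_left _ (by omega)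
    rw [add_mul]
    omega
  · obtain ⟨F, hFE, hF, hFk⟩ : ∃ F : Finset (Fin x.n × Fin x.n),
        F ⊆ x.edges ∧ x.Connects F ∧ F.card ≤ k := by
      obtain ⟨F, ⟨hFE, hF⟩, hcost⟩ := Nat.sInf_mem (hne.image (SCSS.cost x))
      exact ⟨F, hFE, hF, hcost.trans_le hopt⟩
    obtain ⟨G, hG, hcard, hreach, hk, hraw⟩ := hpost ⟨toNat F, Finset.image_subset_image hFE,
      by rwa [card_toNat], connects_iff.1 hF⟩
    obtain ⟨F', hF', rfl⟩ := exists_toNat_eq hG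
    have hl : σ.len = L := by
      rw [← hσ.len, hr 0 (by omega)]
      rfl
    refine ⟨F', ⟨hF', connects_iff.2 hreach⟩, hasOutput_of_rep hσ hk (by omega) hraw, ?_⟩
    rw [card_toNat] at hcard
    change (F'.card : ℝ) ≤ k * 2
    exact_mod_cast (by omega : F'.card ≤ k * 2)
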